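/- For $n\ge 1$, let $\mathcal{S}_n$ be the symmetric group on $[n]=\{1,\dots,n\}$, and identify each $\sigma\in\mathcal{S}_n$ with the set $\{x_{1\sigma(1)},\dots,x_{n\sigma(n)}\}$ of $n$ of the $n^2$ points $x_{ij}$ $(1\le i,j\le n)$. A family $\mathcal{F}\subset\mathcal{S}_n$ is called intersecting if for all $\sigma,\pi\in\mathcal{F}$ there is $i\in[n]$ with $\sigma(i)=\pi(i)$. The diversity of $\mathcal{F}$ is $$\gamma(\mathcal{F})=\min_{1\le i,j\le n}\bigl|\{F\in\mathcal{F}\colon x_{ij}\notin F\}\bigr|.$$ If $n\ge 500$ and $\mathcal{F}\subset\mathcal{S}_n$ is intersecting, then $$\gamma(\mathcal{F})\le (n-3)\,(n-3)!.$$ This bound is best possible: for every $n\ge 3$ the triangle family $$\mathcal{T}(n)=\bigl\{F\in\mathcal{S}_n\colon |F\cap\{x_{11},x_{22},x_{33}\}|\ge 2\bigr\}$$ is intersecting and satisfies $\gamma(\mathcal{T}(n))=(n-3)\,(n-3)!$. -/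

import Mathlib

open scoped Nat

/-- The diversity of a family of subsets of a finite ground set `α`: the minimum, over the points
`x` of the ground set, of the number of members of the family that do not contain `x`.
(For nonempty `α` this infimum of natural numbers is attained.) -/
noncomputable def setDiversity {α : Type*} [DecidableEq α]
    (𝓐 : Finset (Finset α)) : ℕ :=
  ⨅ x : α, (𝓐.filter (fun A => x ∉ A)).card

/-- A permutation `σ` of `Fin n`, seen as the set of points `(i, σ i)`;
the pair `(i, j)` plays the role of the point `x_{ij}`. -/
def permEdge {n : ℕ} (σ : Equiv.Perm (Fin n)) : Finset (Fin n × Fin n) :=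
  Finset.univ.image (fun i => (i, σ i))

/-- Any two members of the family agree in some position. -/
def IsIntersectingPerms {n : ℕ} (𝓕 : Finset (Equiv.Perm (Fin n))) : Prop :=
  ∀ σ ∈ 𝓕, ∀ π ∈ 𝓕, ∃ i : Fin n, σ i = π i

/-- The diversity of a family of permutations: the diversity of the corresponding family of
`n`-element subsets of the `n²` points `(i, j)`. -/
noncomputable def permDiversity {n : ℕ} (𝓕 : Finset (Equiv.Perm (Fin n))) : ℕ :=
  setDiversity (𝓕.image permEdge)

/-- The first three diagonal points `x_{11}, x_{22}, x_{33}` (which are `(0, 0), (1, 1), (2, 2)`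
in the zero-based indexing of `Fin n`). -/
def diagonalTriple (n : ℕ) : Finset (Fin n × Fin n) :=
  Finset.univ.filter (fun p => p.1 = p.2 ∧ (p.1 : ℕ) < 3)

/-- The triangle family: the permutations containing at least two of the first three
diagonal points. -/
def triangleFamily (n : ℕ) : Finset (Equiv.Perm (Fin n)) :=
  Finset.univ.filter (fun σ => 2 ≤ (permEdge σ ∩ diagonalTriple n).card)

/-!
Identify a permutation with its set of `n` points `(i, σ i)`, and call the number of members of a
family through a point set `P`, divided by `(n - |P|)!`, its proportion at `P`. Suppose that `𝓕` is
intersecting and that for every point `x` more than `(n - 3) * (n - 3)!` members avoid `x`; this is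
a proportion of nearly `1 / n ^ 2`.

*Small covers.* If `𝓐` and `𝓑` are cross-intersecting and `𝓐` has proportion at least a constant
times `1 / n ^ 2`, then a bounded number of points meets all of `𝓑` up to another proportion of
this order (`SmallCover`). The proof is by branching (`card_through_le_of_branching`): if the
members of `𝓐` through `U` nearly all meet a set `Z`, then their proportion at `U` is about
`|Z| / (n - |U|)` times the largest proportion at a set `U ∪ {z}`. For `Z` one first takes the
points of a member `π` of `𝓑` that avoids `U`. Only points of `π` in rows and columns unused by `U`
count, and since `𝓑` is dense it contains a `π` that wastes few rows of `U` on columns of `U`. Once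
`|U|` is of order `n` each step then gains a constant factor, and within `13 n / 25` steps the
proportion falls below `1 / (10 n ^ 2)` (`smallCover_base`). Hence some `U` with at most that many
points is itself a cover of `𝓑` up to a small proportion. Since covers are sets to branch on, with a
factor `|Z| / n` at each step, they improve themselves (`SmallCover.improve`): the sizes go down
from `13 n / 25` to `√(2 n)` to `6`.

*Structure.* Apply covers of six points to `𝓕`, which is dense, and then to the members through a
point `z`, which cross-intersect the many members avoiding `z`. Up to few exceptions this places
`𝓕` on the permutations through one of `36` pairs. A pair that is not met by almost all of `𝓕` has
a further cover of its own, so few members contain it; hence the almost covering pairs carry `𝓕`,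
and they cannot have a common point (`exists_almostCovers_pair`). Two disjoint almost covering pairs
would split `𝓕` into four parts, opposite ones cross-intersecting, so that one of each two opposite
parts is negligible and the rest is a star (`not_disjoint_almostCovers`). What remains is a triangle
of almost covering pairs. A member with at most one of its vertices would be met by all members
through two vertices that it avoids, which by derangements excludes at least a third of them
(`three_mul_card_meet_le`); so every member contains two of the three points, and the diversity is
at most that of the triangle family (`not_triangle_almostCovers`).
-/

section Permutations

variable {n : ℕ}

/-! ### Members through and off a set of points -/

/-- The members of `𝓕` that contain every point of `P`. -/
def through {n : ℕ} (𝓕 : Finset (Equiv.Perm (Fin n))) (P : Finset (Fin n × Fin n)) :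
    Finset (Equiv.Perm (Fin n)) :=
  𝓕.filter (fun σ => ∀ x ∈ P, σ x.1 = x.2)

/-- The members of `𝓕` that contain no point of `P`. -/
def missing {n : ℕ} (𝓕 : Finset (Equiv.Perm (Fin n))) (P : Finset (Fin n × Fin n)) :
    Finset (Equiv.Perm (Fin n)) :=
  𝓕.filter (fun σ => ∀ x ∈ P, σ x.1 ≠ x.2)

/-- Every member of `𝓐` agrees somewhere with every member of `𝓑`. -/
def CrossIntersecting {n : ℕ} (𝓐 𝓑 : Finset (Equiv.Perm (Fin n))) : Prop :=
  ∀ σ ∈ 𝓐, ∀ π ∈ 𝓑, ∃ i : Fin n, σ i = π i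


theorem mem_through {𝓕 : Finset (Equiv.Perm (Fin n))} {P : Finset (Fin n × Fin n)}
    {σ : Equiv.Perm (Fin n)} : σ ∈ through 𝓕 P ↔ σ ∈ 𝓕 ∧ ∀ x ∈ P, σ x.1 = x.2 := by
  simp [through]

theorem mem_missing {𝓕 : Finset (Equiv.Perm (Fin n))} {P : Finset (Fin n × Fin n)}
    {σ : Equiv.Perm (Fin n)} : σ ∈ missing 𝓕 P ↔ σ ∈ 𝓕 ∧ ∀ x ∈ P, σ x.1 ≠ x.2 := by
  simp [missing]

theorem through_subset (𝓕 : Finset (Equiv.Perm (Fin n))) (P : Finset (Fin n × Fin n)) :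
    through 𝓕 P ⊆ 𝓕 := Finset.filter_subset _ _

theorem missing_subset (𝓕 : Finset (Equiv.Perm (Fin n))) (P : Finset (Fin n × Fin n)) :
    missing 𝓕 P ⊆ 𝓕 := Finset.filter_subset _ _

theorem card_image_fst {P : Finset (Fin n × Fin n)} {τ : Equiv.Perm (Fin n)}
    (hτ : ∀ x ∈ P, τ x.1 = x.2) : (P.image Prod.fst).card = P.card := by
  apply Finset.card_image_of_injOn
  intro x hx y hy h
  have h1 := hτ x hx
  have h2 := hτ y hy
  have h' : x.1 = y.1 := h
  exact Prod.ext h' (by rw [← h1, ← h2, h'])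

theorem card_image_snd {P : Finset (Fin n × Fin n)} {τ : Equiv.Perm (Fin n)}
    (hτ : ∀ x ∈ P, τ x.1 = x.2) : (P.image Prod.snd).card = P.card := by
  apply Finset.card_image_of_injOn
  intro x hx y hy h
  have h1 := hτ x hx
  have h2 := hτ y hy
  have h' : x.2 = y.2 := h
  refine Prod.ext (τ.injective ?_) h'
  rw [h1, h2, h']

/-- If `P` extends to a permutation at all, it extends to `(n - |P|)!` of them. -/
theorem card_through_univ {P : Finset (Fin n × Fin n)} {τ : Equiv.Perm (Fin n)}
    (hτ : ∀ x ∈ P, τ x.1 = x.2) :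
    (through (Finset.univ : Finset (Equiv.Perm (Fin n))) P).card = (n - P.card)! := by
  have hR := card_image_fst hτ
  set R := P.image Prod.fst with hRdef
  -- Left multiplication by `τ⁻¹` turns the condition into fixing the rows of `P` pointwise.
  have e : {σ : Equiv.Perm (Fin n) // ∀ x ∈ P, σ x.1 = x.2} ≃
      {f : Equiv.Perm (Fin n) // ∀ a, ¬ (a ∉ R) → f a = a} := by
    refine (Equiv.mulLeft τ⁻¹).subtypeEquiv ?_
    intro σ
    constructor
    · intro h a ha
      obtain ⟨x, hx, rfl⟩ := Finset.mem_image.1 (not_not.1 ha)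
      simp [h x hx, ← hτ x hx]
    · intro h x hx
      have := h x.1 (not_not.2 (Finset.mem_image_of_mem _ hx))
      simp only [Equiv.coe_mulLeft, Equiv.Perm.mul_apply] at this
      rw [Equiv.Perm.inv_eq_iff_eq] at this
      rw [this, hτ x hx]
  have h1 : (through (Finset.univ : Finset (Equiv.Perm (Fin n))) P).card
      = Fintype.card {σ : Equiv.Perm (Fin n) // ∀ x ∈ P, σ x.1 = x.2} :=
    (Fintype.card_subtype _).symm
  rw [h1, Fintype.card_congr e,
    Fintype.card_congr (Equiv.Perm.subtypeEquivSubtypePerm (fun a => a ∉ R)).symm,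
    Fintype.card_perm, Fintype.card_subtype_compl, Fintype.card_fin, Fintype.card_coe, hR]

theorem card_through_le (𝓕 : Finset (Equiv.Perm (Fin n))) (P : Finset (Fin n × Fin n)) :
    (through 𝓕 P).card ≤ (n - P.card)! := by
  rcases (through 𝓕 P).eq_empty_or_nonempty with h | ⟨τ, hτ⟩
  · simp [h]
  · rw [← card_through_univ (mem_through.1 hτ).2]
    exact Finset.card_le_card (Finset.filter_subset_filter _ (Finset.subset_univ _))

/-- A member of `𝓕` contains a point of `Z` or no point of `Z`. -/
theorem card_le_missing_add_sum (𝓕 : Finset (Equiv.Perm (Fin n))) (Z : Finset (Fin n × Fin n)) :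
    𝓕.card ≤ (missing 𝓕 Z).card + ∑ z ∈ Z, (through 𝓕 {z}).card := by
  have h : 𝓕 ⊆ missing 𝓕 Z ∪ Z.biUnion (fun z => through 𝓕 {z}) := by
    intro σ hσ
    by_cases hm : ∀ x ∈ Z, σ x.1 ≠ x.2
    · exact Finset.mem_union_left _ (mem_missing.2 ⟨hσ, hm⟩)
    · push Not at hm
      obtain ⟨x, hx, hx'⟩ := hm
      refine Finset.mem_union_right _ (Finset.mem_biUnion.2 ⟨x, hx, mem_through.2 ⟨hσ, ?_⟩⟩)
      simpa using hx'
  calc 𝓕.card ≤ _ := Finset.card_le_card h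
    _ ≤ _ := Finset.card_union_le _ _
    _ ≤ _ := Nat.add_le_add_left Finset.card_biUnion_le _

theorem through_through (𝓕 : Finset (Equiv.Perm (Fin n))) (P Q : Finset (Fin n × Fin n)) :
    through (through 𝓕 P) Q = through 𝓕 (P ∪ Q) := by
  ext σ
  simp only [mem_through, Finset.mem_union]
  constructor
  · rintro ⟨⟨h1, h2⟩, h3⟩
    exact ⟨h1, fun x hx => hx.elim (h2 x) (h3 x)⟩
  · rintro ⟨h1, h2⟩
    exact ⟨⟨h1, fun x hx => h2 x (Or.inl hx)⟩, fun x hx => h2 x (Or.inr hx)⟩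

/-! ### Branching -/

/-- Branching: suppose that for every `U ⊇ V` with fewer than `T` points the members through `U`,
up to a proportion `e`, meet a set `Z` of further points that is small relative to `n - |U|`.
Descending from `|U| = T` to `U = V` bounds the number of members through `V`. The sequence `b`
holds the bounds for the proportions at the successive sizes of `U`. -/
theorem card_through_le_of_branching {𝓐 : Finset (Equiv.Perm (Fin n))}
    {V : Finset (Fin n × Fin n)} {T : ℕ} {e : ℝ} {b : ℕ → ℝ} (hVT : V.card ≤ T) (hT : T ≤ n)
    (hb0 : ∀ t, 0 ≤ b t) (hbT : 1 ≤ b T)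
    (hstep : ∀ U, V ⊆ U → U.card < T → (through 𝓐 U).Nonempty → ∃ Z, Disjoint Z U ∧
      ((missing (through 𝓐 U) Z).card : ℝ) ≤ e * (n - U.card)! ∧
      Z.card * b (U.card + 1) + e * (n - U.card : ℝ) ≤ b U.card * (n - U.card : ℝ)) :
    ((through 𝓐 V).card : ℝ) ≤ b V.card * (n - V.card)! := by
  suffices H : ∀ j U, V ⊆ U → U.card + j = T →
      ((through 𝓐 U).card : ℝ) ≤ b U.card * (n - U.card)! from
    H (T - V.card) V subset_rfl (by omega)
  intro j
  induction j with
  | zero =>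
    intro U _ hU
    have h1 : ((through 𝓐 U).card : ℝ) ≤ (n - U.card)! := by
      exact_mod_cast card_through_le 𝓐 U
    have h2 : b U.card = b T := by rw [← hU, add_zero]
    have h3 : (0 : ℝ) ≤ (n - U.card)! := by positivity
    rw [h2]
    nlinarith
  | succ j ih =>
    intro U hVU hU
    rcases (through 𝓐 U).eq_empty_or_nonempty with hE | hne
    · rw [hE]
      have := hb0 U.card
      simp only [Finset.card_empty, Nat.cast_zero]
      positivity
    obtain ⟨Z, hZU, hmiss, hb⟩ := hstep U hVU (by omega) hne
    have hUn : U.card < n := by omega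
    have hfac : ((n - U.card)! : ℝ) = (n - U.card : ℝ) * (n - (U.card + 1))! := by
      have h : n - U.card = (n - (U.card + 1)) + 1 := by omega
      rw [h, Nat.factorial_succ]
      push_cast [Nat.cast_sub (show U.card + 1 ≤ n from hUn)]
      ring
    have hsum : ∑ z ∈ Z, ((through (through 𝓐 U) {z}).card : ℝ)
        ≤ ∑ _z ∈ Z, b (U.card + 1) * (n - (U.card + 1))! := by
      refine Finset.sum_le_sum fun z hz => ?_
      have hzU : z ∉ U := Finset.disjoint_left.1 hZU hz
      have hc : (U ∪ {z}).card = U.card + 1 := by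
        rw [Finset.union_comm, ← Finset.insert_eq, Finset.card_insert_of_notMem hzU]
      have := ih (U ∪ {z}) (hVU.trans Finset.subset_union_left) (by omega)
      rwa [hc, ← through_through] at this
    have hcard : ((through 𝓐 U).card : ℝ) ≤ (missing (through 𝓐 U) Z).card
        + ∑ z ∈ Z, ((through (through 𝓐 U) {z}).card : ℝ) := by
      exact_mod_cast card_le_missing_add_sum (through 𝓐 U) Z
    rw [Finset.sum_const, nsmul_eq_mul] at hsum
    have hpos : (0 : ℝ) < (n - (U.card + 1))! := by positivity
    rw [hfac] at hmiss ⊢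
    calc ((through 𝓐 U).card : ℝ)
        ≤ (Z.card * b (U.card + 1) + e * (n - U.card : ℝ)) * (n - (U.card + 1))! := by linarith
      _ ≤ b U.card * (n - U.card : ℝ) * (n - (U.card + 1))! :=
        mul_le_mul_of_nonneg_right hb hpos.le
      _ = _ := by ring

/-! ### Covers and their improvement -/

/-- Small covers: whenever `𝓐` and `𝓑` are cross-intersecting, `𝓐` lives on the permutations
through `V` and off `W`, `𝓑` on those through `W` and off `V`, and `𝓐` has proportion at least `ε`
among the permutations through `V`, there are at most `T` points outside `W` that meet `𝓑` up to
a proportion `ε'` of the permutations through `W`. The sets `V` and `W` have at most `w` points. -/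
def SmallCover (n T w : ℕ) (ε ε' : ℝ) : Prop :=
  ∀ (V W : Finset (Fin n × Fin n)) (𝓐 𝓑 : Finset (Equiv.Perm (Fin n))),
    V.card ≤ w → W.card ≤ w →
    (∀ σ ∈ 𝓐, (∀ x ∈ V, σ x.1 = x.2) ∧ ∀ x ∈ W, σ x.1 ≠ x.2) →
    (∀ π ∈ 𝓑, (∀ x ∈ W, π x.1 = x.2) ∧ ∀ x ∈ V, π x.1 ≠ x.2) →
    CrossIntersecting 𝓐 𝓑 → ε * (n - V.card)! ≤ 𝓐.card →
    ∃ Z : Finset (Fin n × Fin n), Z.card ≤ T ∧ Disjoint Z W ∧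
      ((missing 𝓑 Z).card : ℝ) ≤ ε' * (n - W.card)!

theorem through_eq_self {𝓐 : Finset (Equiv.Perm (Fin n))} {V : Finset (Fin n × Fin n)}
    (h : ∀ σ ∈ 𝓐, ∀ x ∈ V, σ x.1 = x.2) : through 𝓐 V = 𝓐 :=
  Finset.filter_true_of_mem h

theorem disjoint_of_through_nonempty {𝓐 : Finset (Equiv.Perm (Fin n))}
    {U W : Finset (Fin n × Fin n)} (h : ∀ σ ∈ 𝓐, ∀ x ∈ W, σ x.1 ≠ x.2)
    (hne : (through 𝓐 U).Nonempty) : Disjoint U W := by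
  obtain ⟨σ, hσ⟩ := hne
  rw [mem_through] at hσ
  exact Finset.disjoint_left.2 fun x hxU hxW => h σ hσ.1 x hxW (hσ.2 x hxU)

/-- Covers improve themselves: if the dense family had no cover with `T'` points, then branching
`T'` times, each time into the at most `T` points of an already known cover, would show that it
is not dense. -/
theorem SmallCover.improve {T T' w w' : ℕ} {ε ε' ε'' ρ : ℝ} (h : SmallCover n T w ε' ε'')
    (hw : w' + T' ≤ w) (hwn : w ≤ n) (hρ0 : 0 ≤ ρ) (hρ1 : ρ < 1) (hε'' : 0 ≤ ε'')
    (hT : (T : ℝ) ≤ ρ * (n - w)) (hε : ρ ^ T' + ε'' / (1 - ρ) < ε) :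
    SmallCover n T' w' ε ε' := by
  intro V W 𝓐 𝓑 hV hW h𝓐 h𝓑 hcross hdense
  by_contra! hno
  have hs : 0 < 1 - ρ := by linarith
  set s : ℝ := ε'' / (1 - ρ) with hsdef
  have hs0 : 0 ≤ s := div_nonneg hε'' hs.le
  have hss : ε'' = s * (1 - ρ) := by rw [hsdef]; field_simp
  set v := V.card with hv
  have key := card_through_le_of_branching (𝓐 := 𝓐) (V := V) (T := v + T') (e := ε'')
    (b := fun t => ρ ^ (v + T' - t) + s) (by omega) (by omega)
    (fun t => by positivity) (by simpa using hs0) ?_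
  · rw [through_eq_self fun σ hσ => (h𝓐 σ hσ).1] at key
    have hfp : (0 : ℝ) < (n - v)! := by positivity
    simp only [← hv, Nat.add_sub_cancel_left] at key
    have := mul_lt_mul_of_pos_right hε hfp
    linarith
  intro U hVU hUT hne
  have hUW : Disjoint U W := disjoint_of_through_nonempty (fun σ hσ => (h𝓐 σ hσ).2) hne
  have hcU : (U \ V).card + v = U.card := Finset.card_sdiff_add_card_eq_card hVU
  have hdB := hno (U \ V) (by omega) (hUW.mono_left Finset.sdiff_subset)
  obtain ⟨Z, hZT, hZU, hZ⟩ := h W U (missing 𝓑 (U \ V)) (through 𝓐 U) (by omega) (by omega)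
    (by
      intro π hπ
      rw [mem_missing] at hπ
      refine ⟨(h𝓑 π hπ.1).1, fun x hx => ?_⟩
      by_cases hxV : x ∈ V
      · exact (h𝓑 π hπ.1).2 x hxV
      · exact hπ.2 x (Finset.mem_sdiff.2 ⟨hx, hxV⟩))
    (by
      intro σ hσ
      rw [mem_through] at hσ
      exact ⟨hσ.2, (h𝓐 σ hσ.1).2⟩)
    (by
      intro π hπ σ hσ
      obtain ⟨i, hi⟩ := hcross σ (mem_through.1 hσ).1 π (mem_missing.1 hπ).1
      exact ⟨i, hi.symm⟩)
    hdB.le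
  refine ⟨Z, hZU, hZ, ?_⟩
  have hpow : ρ ^ (v + T' - U.card) = ρ * ρ ^ (v + T' - (U.card + 1)) := by
    rw [← pow_succ']
    congr 1
    omega
  simp only [hpow]
  set q := ρ ^ (v + T' - (U.card + 1))
  have hq : 0 ≤ q := by positivity
  have hUw : (U.card : ℝ) ≤ w := by exact_mod_cast (by omega : U.card ≤ w)
  have hZr : (Z.card : ℝ) ≤ ρ * (n - U.card) := by
    calc (Z.card : ℝ) ≤ T := by exact_mod_cast hZT
      _ ≤ ρ * (n - w) := hT
      _ ≤ ρ * (n - U.card) := by gcongr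
  calc Z.card * (q + s) + ε'' * (n - U.card : ℝ)
      ≤ ρ * (n - U.card) * (q + s) + ε'' * (n - U.card : ℝ) := by gcongr
    _ = (ρ * q + s) * (n - U.card) := by rw [hss]; ring

/-! ### Overlaps of a random permutation with a point set -/

/-- The permutations through `W` that send `K` into `J`, counted by choosing the values on `K` one
after another. -/
theorem card_through_mapsTo_le (K : Finset (Fin n)) :
    ∀ (W : Finset (Fin n × Fin n)) (J : Finset (Fin n)), (∀ x ∈ W, x.1 ∉ K) →
    ((through (Finset.univ : Finset (Equiv.Perm (Fin n))) W).filter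
      (fun π => ∀ i ∈ K, π i ∈ J)).card
      ≤ J.card.descFactorial K.card * (n - W.card - K.card)! := by
  induction K using Finset.induction_on with
  | empty =>
    intro W J _
    simpa using card_through_le Finset.univ W
  | insert i K hi ih =>
    intro W J hW
    have hsub : (through (Finset.univ : Finset (Equiv.Perm (Fin n))) W).filter
        (fun π => ∀ i' ∈ insert i K, π i' ∈ J) ⊆ J.biUnion (fun j =>
          (through (Finset.univ : Finset (Equiv.Perm (Fin n))) (insert (i, j) W)).filter
            (fun π => ∀ i' ∈ K, π i' ∈ J.erase j)) := by
      intro π hπ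
      rw [Finset.mem_filter, mem_through] at hπ
      obtain ⟨⟨_, h1⟩, h2⟩ := hπ
      refine Finset.mem_biUnion.2 ⟨π i, h2 i (Finset.mem_insert_self _ _), ?_⟩
      rw [Finset.mem_filter, mem_through]
      refine ⟨⟨Finset.mem_univ _, ?_⟩, ?_⟩
      · intro x hx
        rcases Finset.mem_insert.1 hx with rfl | hx
        · rfl
        · exact h1 x hx
      · intro i' hi'
        refine Finset.mem_erase.2 ⟨fun h => ?_, h2 i' (Finset.mem_insert_of_mem hi')⟩
        rw [π.injective h] at hi'
        exact hi hi'
    have hterm : ∀ j ∈ J, ((through (Finset.univ : Finset (Equiv.Perm (Fin n)))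
        (insert (i, j) W)).filter (fun π => ∀ i' ∈ K, π i' ∈ J.erase j)).card
        ≤ (J.card - 1).descFactorial K.card * (n - W.card - (K.card + 1))! := by
      intro j hj
      have hnot : (i, j) ∉ W := fun h => hW _ h (Finset.mem_insert_self _ _)
      have := ih (insert (i, j) W) (J.erase j) (by
        intro x hx
        rcases Finset.mem_insert.1 hx with rfl | hx
        · exact hi
        · exact fun h => hW x hx (Finset.mem_insert_of_mem h))
      rw [Finset.card_insert_of_notMem hnot, Finset.card_erase_of_mem hj] at this
      convert this using 3
      omega
    rw [Finset.card_insert_of_notMem hi]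
    calc _ ≤ _ := Finset.card_le_card hsub
      _ ≤ _ := Finset.card_biUnion_le
      _ ≤ _ := Finset.sum_le_sum hterm
      _ = J.card.descFactorial (K.card + 1) * (n - W.card - (K.card + 1))! := by
        rw [Finset.sum_const, smul_eq_mul, ← mul_assoc]
        rcases Nat.eq_zero_or_pos J.card with h0 | hpos
        · simp [h0]
        · obtain ⟨c, hc⟩ := Nat.exists_eq_succ_of_ne_zero hpos.ne'
          rw [hc, Nat.succ_descFactorial_succ]
          simp

theorem descFactorial_mul_pow_le {t N : ℕ} (htN : t ≤ N) (k : ℕ) :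
    t.descFactorial k * N ^ k ≤ t ^ k * N.descFactorial k := by
  induction k with
  | zero => simp
  | succ k ih =>
    rw [Nat.descFactorial_succ, Nat.descFactorial_succ, pow_succ, pow_succ]
    have h : (t - k) * N ≤ t * (N - k) := by
      rcases le_total t k with h | h
      · simp [Nat.sub_eq_zero_of_le h]
      · obtain ⟨d, rfl⟩ := Nat.exists_eq_add_of_le h
        obtain ⟨c, rfl⟩ := Nat.exists_eq_add_of_le htN
        have h1 : k + d - k = d := by omega
        have h2 : k + d + c - k = d + c := by omega
        rw [h1, h2]
        nlinarith [Nat.zero_le (k * c)]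
    calc (t - k) * t.descFactorial k * (N ^ k * N)
        = (t.descFactorial k * N ^ k) * ((t - k) * N) := by ring
      _ ≤ (t ^ k * N.descFactorial k) * (t * (N - k)) := Nat.mul_le_mul ih h
      _ = _ := by ring

/-- The exponential moment of the number of rows of `I` that a uniformly random permutation
through `W` sends into `J`; it is dominated by that of a binomial variable. -/
theorem sum_two_pow_overlap_le {W : Finset (Fin n × Fin n)} {I J : Finset (Fin n)} {N t : ℕ}
    (hN : n - W.card = N) (hI : I.card = t) (hJ : J.card = t) (htN : t ≤ N) (hN0 : 0 < N)
    (hWI : ∀ x ∈ W, x.1 ∉ I) :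
    ∑ π ∈ through (Finset.univ : Finset (Equiv.Perm (Fin n))) W,
      (2 : ℝ) ^ (I.filter (fun i => π i ∈ J)).card ≤ N ! * (1 + t / N : ℝ) ^ t := by
  have hN0' : (0 : ℝ) < N := by exact_mod_cast hN0
  have hpow : ∀ π : Equiv.Perm (Fin n), (2 : ℝ) ^ (I.filter (fun i => π i ∈ J)).card
      = ∑ K ∈ I.powerset, if (∀ i ∈ K, π i ∈ J) then (1 : ℝ) else 0 := by
    intro π
    rw [← Finset.sum_filter, Finset.sum_const, nsmul_eq_mul, mul_one]
    have : I.powerset.filter (fun K => ∀ i ∈ K, π i ∈ J)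
        = (I.filter (fun i => π i ∈ J)).powerset := by
      ext K
      simp only [Finset.mem_filter, Finset.mem_powerset, Finset.subset_iff]
      exact ⟨fun h i hi => ⟨h.1 hi, h.2 i hi⟩, fun h => ⟨fun i hi => (h hi).1, fun i hi => (h hi).2⟩⟩
    rw [this, Finset.card_powerset]
    push_cast
    rfl
  simp only [hpow]
  rw [Finset.sum_comm]
  have hterm : ∀ K ∈ I.powerset,
      (∑ π ∈ through (Finset.univ : Finset (Equiv.Perm (Fin n))) W,
        if (∀ i ∈ K, π i ∈ J) then (1 : ℝ) else 0) ≤ N ! * ((t / N : ℝ) ^ K.card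
          * 1 ^ (I.card - K.card)) := by
    intro K hK
    rw [Finset.mem_powerset] at hK
    have hKN : K.card ≤ N := (Finset.card_le_card hK).trans (hI.le.trans htN)
    have h1 := card_through_mapsTo_le K W J (fun x hx h => hWI x hx (hK h))
    rw [hN, hJ] at h1
    rw [← Finset.sum_filter, Finset.sum_const, nsmul_eq_mul, mul_one, one_pow, mul_one, div_pow,
      mul_div_assoc', le_div_iff₀ (by positivity)]
    have h2 := descFactorial_mul_pow_le htN K.card
    have h3 := Nat.factorial_mul_descFactorial hKN
    have h4 : ((through (Finset.univ : Finset (Equiv.Perm (Fin n))) W).filter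
        (fun π => ∀ i ∈ K, π i ∈ J)).card * N ^ K.card ≤ N ! * t ^ K.card := by
      calc _ ≤ t.descFactorial K.card * (N - K.card)! * N ^ K.card := Nat.mul_le_mul_right _ h1
        _ = (t.descFactorial K.card * N ^ K.card) * (N - K.card)! := by ring
        _ ≤ (t ^ K.card * N.descFactorial K.card) * (N - K.card)! := Nat.mul_le_mul_right _ h2
        _ = ((N - K.card)! * N.descFactorial K.card) * t ^ K.card := by ring
        _ = _ := by rw [h3]
    exact_mod_cast h4
  calc _ ≤ _ := Finset.sum_le_sum hterm
    _ = _ := by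
      rw [← Finset.mul_sum, Finset.sum_pow_mul_eq_add_pow, hI, add_comm]

theorem exists_small_overlap {W : Finset (Fin n × Fin n)} {I J : Finset (Fin n)} {N t : ℕ}
    {𝓑 : Finset (Equiv.Perm (Fin n))} {ε : ℝ}
    (hN : n - W.card = N) (hI : I.card = t) (hJ : J.card = t) (htN : t ≤ N) (hN0 : 0 < N)
    (hWI : ∀ x ∈ W, x.1 ∉ I) (hε : 0 < ε) (h𝓑 : ∀ π ∈ 𝓑, ∀ x ∈ W, π x.1 = x.2)
    (hdense : ε * N ! < 𝓑.card) :
    ∃ π ∈ 𝓑, ε * 2 ^ (I.filter (fun i => π i ∈ J)).card ≤ (1 + t / N : ℝ) ^ t := by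
  by_contra! hno
  have hM : (0 : ℝ) < (1 + t / N : ℝ) ^ t := by positivity
  have h1 : 𝓑.card * (1 + t / N : ℝ) ^ t
      ≤ ∑ π ∈ 𝓑, ε * (2 : ℝ) ^ (I.filter (fun i => π i ∈ J)).card := by
    rw [← nsmul_eq_mul, ← Finset.sum_const]
    exact Finset.sum_le_sum fun π hπ => (hno π hπ).le
  have h2 : ∑ π ∈ 𝓑, ε * (2 : ℝ) ^ (I.filter (fun i => π i ∈ J)).card
      ≤ ε * (N ! * (1 + t / N : ℝ) ^ t) := by
    rw [← Finset.mul_sum]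
    refine mul_le_mul_of_nonneg_left (le_trans ?_ (sum_two_pow_overlap_le hN hI hJ htN hN0 hWI))
      hε.le
    refine Finset.sum_le_sum_of_subset_of_nonneg (fun π hπ => ?_) (fun _ _ _ => by positivity)
    exact mem_through.2 ⟨Finset.mem_univ _, h𝓑 π hπ⟩
  have h3 := mul_lt_mul_of_pos_right hdense hM
  linarith

/-- The points of `π` outside `W` that share no row and no column with `U`. -/
theorem card_compatible_le {W U : Finset (Fin n × Fin n)} {I J : Finset (Fin n)}
    {π : Equiv.Perm (Fin n)} (hπ : ∀ x ∈ W, π x.1 = x.2)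
    (hI : I ⊆ U.image Prod.fst \ W.image Prod.fst)
    (hJ : J ⊆ U.image Prod.snd \ W.image Prod.snd) :
    (Finset.univ.filter (fun i => i ∉ W.image Prod.fst ∧ i ∉ U.image Prod.fst ∧
      π i ∉ U.image Prod.snd)).card + I.card + J.card
      ≤ (n - W.card) + (I.filter (fun i => π i ∈ J)).card := by
  set C := Finset.univ.filter (fun i => i ∉ W.image Prod.fst ∧ i ∉ U.image Prod.fst ∧
      π i ∉ U.image Prod.snd) with hC
  set E := Finset.univ.filter (fun i => π i ∈ J) with hE
  have hEJ : E.card = J.card := by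
    have : E.image π = J := by
      ext j
      simp only [hE, Finset.mem_image, Finset.mem_filter, Finset.mem_univ, true_and]
      exact ⟨by rintro ⟨i, hi, rfl⟩; exact hi, fun hj => ⟨π.symm j, by simpa using hj, by simp⟩⟩
    rw [← this, Finset.card_image_of_injective _ π.injective]
  have hIE : I ∩ E = I.filter (fun i => π i ∈ J) := by
    ext i; simp [hE]
  have hdisj : Disjoint C (I ∪ E) := by
    rw [Finset.disjoint_left]
    intro i hi hi'
    rw [hC, Finset.mem_filter] at hi
    rcases Finset.mem_union.1 hi' with h | h
    · exact hi.2.2.1 (Finset.mem_sdiff.1 (hI h)).1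
    · rw [hE, Finset.mem_filter] at h
      exact hi.2.2.2 (Finset.mem_sdiff.1 (hJ h.2)).1
  have hsub : C ∪ (I ∪ E) ⊆ (W.image Prod.fst)ᶜ := by
    intro i hi
    rw [Finset.mem_compl]
    rcases Finset.mem_union.1 hi with h | h
    · rw [hC, Finset.mem_filter] at h
      exact h.2.1
    rcases Finset.mem_union.1 h with h | h
    · exact (Finset.mem_sdiff.1 (hI h)).2
    · intro hiW
      obtain ⟨x, hx, rfl⟩ := Finset.mem_image.1 hiW
      rw [hE, Finset.mem_filter, hπ x hx] at h
      exact (Finset.mem_sdiff.1 (hJ h.2)).2 (Finset.mem_image_of_mem _ hx)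
  have h1 := Finset.card_le_card hsub
  rw [Finset.card_union_of_disjoint hdisj, Finset.card_compl, Fintype.card_fin,
    card_image_fst hπ] at h1
  have h2 := Finset.card_union_add_card_inter I E
  rw [hIE] at h2
  omega

/-! ### The first covers -/

theorem ten_mul_sq_le_exp (hn : 500 ≤ n) : (10 * (n : ℝ) ^ 2) ≤ Real.exp (n / 31) := by
  have hn' : (500 : ℝ) ≤ n := by exact_mod_cast hn
  have h1 : (n : ℝ) / 500 ≤ Real.exp (n / 500 - 1) := by
    have := Real.add_one_le_exp ((n : ℝ) / 500 - 1)
    linarith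
  have h2 : (2500000 : ℝ) ≤ Real.exp 16 := by
    have h := Real.exp_one_gt_d9
    have h3 : Real.exp 16 = Real.exp 1 ^ 16 := by rw [← Real.exp_nat_mul]; norm_num
    rw [h3]
    calc (2500000 : ℝ) ≤ 2.7 ^ 16 := by norm_num
      _ ≤ _ := by gcongr; linarith
  calc (10 * (n : ℝ) ^ 2) = 2500000 * (n / 500) ^ 2 := by ring
    _ ≤ Real.exp 16 * Real.exp (n / 500 - 1) ^ 2 := by gcongr
    _ = Real.exp (16 + 2 * (n / 500 - 1)) := by rw [Real.exp_add, ← Real.exp_nat_mul]; norm_num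
    _ ≤ Real.exp (n / 31) := by
      apply Real.exp_le_exp.2
      linarith

theorem overlap_le_of_two_pow_le {N t o : ℕ} (hn : 500 ≤ n) (hN : 11 * n ≤ 12 * N)
    (ht : N ≤ 4 * t) (ht' : 2 * t ≤ N)
    (h : 1 / (10 * (n : ℝ) ^ 2) * 2 ^ o ≤ (1 + t / N : ℝ) ^ t) : N + 7 * o ≤ 8 * t := by
  by_contra! hlt
  have hn' : (500 : ℝ) ≤ n := by exact_mod_cast hn
  have hNr : 11 * (n : ℝ) ≤ 12 * N := by exact_mod_cast hN
  have htr : (N : ℝ) ≤ 4 * t := by exact_mod_cast ht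
  have htr' : 2 * (t : ℝ) ≤ N := by exact_mod_cast ht'
  have hltr : 8 * (t : ℝ) ≤ N + 7 * o := by exact_mod_cast hlt.le
  have hN0 : (0 : ℝ) < N := by linarith
  have hx : (1 + t / N : ℝ) ^ t ≤ Real.exp (t * (t / N)) := by
    rw [Real.exp_nat_mul]
    gcongr
    rw [add_comm]
    exact Real.add_one_le_exp _
  have h2 : (2 : ℝ) ^ o ≤ Real.exp (n / 31 + t * (t / N)) := by
    rw [Real.exp_add]
    have hpos : (0 : ℝ) < 10 * (n : ℝ) ^ 2 := by positivity
    have h3 : (2 : ℝ) ^ o ≤ (10 * (n : ℝ) ^ 2) * Real.exp (t * (t / N)) := by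
      have := mul_le_mul_of_nonneg_left (h.trans hx) hpos.le
      rwa [← mul_assoc, mul_one_div_cancel hpos.ne', one_mul] at this
    exact h3.trans (mul_le_mul_of_nonneg_right (ten_mul_sq_le_exp hn) (Real.exp_pos _).le)
  have h4 : o * Real.log 2 ≤ n / 31 + t * (t / N) := by
    have := Real.log_le_log (by positivity) h2
    rwa [Real.log_pow, Real.log_exp] at this
  have hlog : (0.69 : ℝ) ≤ Real.log 2 := by linarith [Real.log_two_gt_d9]
  have h5 : (8 * t - N : ℝ) * 0.69 ≤ 7 * (n / 31 + t * (t / N)) := by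
    have : (8 * t - N : ℝ) * 0.69 ≤ (7 * o) * Real.log 2 :=
      mul_le_mul (by linarith) hlog (by norm_num) (by positivity)
    linarith
  -- The difference is a concave function of `t`, and it is positive at both ends of the range.
  have h6 : (7 * (t * (t / N)) : ℝ) ≤ (8 * t - N) * 0.69 - 0.25 * N := by
    have : (7 * (t * (t / N)) : ℝ) = 7 * t ^ 2 / N := by ring
    rw [this, div_le_iff₀ hN0]
    nlinarith [mul_nonneg (sub_nonneg.2 htr) (sub_nonneg.2 htr')]
  linarith

theorem six_sevenths_pow_lt (hn : 500 ≤ n) : (6 / 7 : ℝ) ^ (n / 5) < 1 / (10 * (n : ℝ) ^ 2) := by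
  have key : ∀ m : ℕ, 100 ≤ m → 250 * ((m : ℝ) + 1) ^ 2 ≤ (7 / 6) ^ m := by
    intro m hm
    induction m, hm using Nat.le_induction with
    | base => norm_num
    | succ m hm ih =>
      have hm' : (100 : ℝ) ≤ m := by exact_mod_cast hm
      rw [pow_succ (7 / 6 : ℝ) m]
      have h : 250 * ((m : ℝ) + 1 + 1) ^ 2 ≤ 250 * ((m : ℝ) + 1) ^ 2 * (7 / 6) := by nlinarith
      push_cast
      linarith
  have h1 := key (n / 5) (by omega)
  have h2 : (n : ℝ) < 5 * ((n / 5 : ℕ) + 1) := by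
    exact_mod_cast (by omega : n < 5 * (n / 5 + 1))
  have hn0 : (0 : ℝ) < n := by exact_mod_cast (by omega : 0 < n)
  have h3 : (10 * (n : ℝ) ^ 2) < (7 / 6) ^ (n / 5) := by
    refine lt_of_lt_of_le ?_ h1
    nlinarith
  have h4 : (6 / 7 : ℝ) ^ (n / 5) = 1 / (7 / 6) ^ (n / 5) := by
    rw [← one_div_pow]; norm_num
  rw [h4]
  exact one_div_lt_one_div_of_lt (by positivity) h3

/-- The first covers, which use somewhat more than half as many points as a permutation has.
Branch on members `π` of `𝓑` that avoid the set `U` reached so far. Only those points of `π`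
matter that share no row and no column with `U`. Once `U` is large, this leaves at most six
sevenths of the available rows, because the dense family `𝓑` has members that send few rows of `U`
into columns of `U`. -/
theorem smallCover_base (hn : 500 ≤ n) :
    SmallCover n (13 * n / 25) (n / 12) (1 / (10 * (n : ℝ) ^ 2)) (1 / (10 * (n : ℝ) ^ 2)) := by
  intro V W 𝓐 𝓑 hV hW h𝓐 h𝓑 hcross hdense
  by_contra! hno
  set ε : ℝ := 1 / (10 * (n : ℝ) ^ 2) with hε
  have hn0 : (0 : ℝ) < n := by exact_mod_cast (by omega : 0 < n)
  have hε0 : 0 < ε := by positivity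
  set w := W.card with hw
  obtain ⟨N, hN⟩ : ∃ N, N = n - w := ⟨_, rfl⟩
  -- The range of sizes of `U` in which each step gains a factor `6 / 7`.
  obtain ⟨a, ha⟩ : ∃ a, a = w + (N + 3) / 4 := ⟨_, rfl⟩
  obtain ⟨T, hT⟩ : ∃ T, T = a + n / 5 := ⟨_, rfl⟩
  have key := card_through_le_of_branching (𝓐 := 𝓐) (V := V) (T := T) (e := 0)
    (b := fun t => (6 / 7 : ℝ) ^ (T - max t a)) (by omega) (by omega)
    (fun t => by positivity) (by simp [show max T a = T by omega]) ?_
  · rw [through_eq_self fun σ hσ => (h𝓐 σ hσ).1] at key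
    have hfp : (0 : ℝ) < (n - V.card)! := by positivity
    have h1 : T - max V.card a = n / 5 := by omega
    simp only [h1] at key
    have := mul_lt_mul_of_pos_right (six_sevenths_pow_lt hn) hfp
    linarith
  intro U hVU hUT hne
  have hUW : Disjoint U W := disjoint_of_through_nonempty (fun σ hσ => (h𝓐 σ hσ).2) hne
  obtain ⟨σ₀, hσ₀⟩ := hne
  have hU₀ := (mem_through.1 hσ₀).2
  have hcU : (U \ V).card + V.card = U.card := Finset.card_sdiff_add_card_eq_card hVU
  have hdB := hno (U \ V) (by omega) (hUW.mono_left Finset.sdiff_subset)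
  have h𝓑U : ∀ π ∈ missing 𝓑 (U \ V), (∀ x ∈ W, π x.1 = x.2) ∧ ∀ x ∈ U, π x.1 ≠ x.2 := by
    intro π hπ
    rw [mem_missing] at hπ
    refine ⟨(h𝓑 π hπ.1).1, fun x hx => ?_⟩
    by_cases hxV : x ∈ V
    · exact (h𝓑 π hπ.1).2 x hxV
    · exact hπ.2 x (Finset.mem_sdiff.2 ⟨hx, hxV⟩)
  -- Any `π` supplies the set of its points compatible with `U`.
  have main : ∀ π ∈ missing 𝓑 (U \ V), ∃ Z : Finset (Fin n × Fin n), Disjoint Z U ∧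
      missing (through 𝓐 U) Z = ∅ ∧ Z.card = (Finset.univ.filter (fun i =>
        i ∉ W.image Prod.fst ∧ i ∉ U.image Prod.fst ∧ π i ∉ U.image Prod.snd)).card := by
    intro π hπ
    have hπ' := h𝓑U π hπ
    refine ⟨(Finset.univ.filter (fun i => i ∉ W.image Prod.fst ∧ i ∉ U.image Prod.fst ∧
      π i ∉ U.image Prod.snd)).image (fun i => (i, π i)), ?_, ?_, ?_⟩
    · rw [Finset.disjoint_right]
      intro x hxU hx
      obtain ⟨i, _, rfl⟩ := Finset.mem_image.1 hx
      exact hπ'.2 _ hxU rfl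
    · rw [Finset.eq_empty_iff_forall_notMem]
      intro σ hσ
      rw [mem_missing, mem_through] at hσ
      obtain ⟨⟨hσ𝓐, hσU⟩, hσZ⟩ := hσ
      obtain ⟨i, hi⟩ := hcross σ hσ𝓐 π (mem_missing.1 hπ).1
      refine hσZ (i, π i) (Finset.mem_image.2 ⟨i, ?_, rfl⟩) hi
      rw [Finset.mem_filter]
      refine ⟨Finset.mem_univ _, fun h => ?_, fun h => ?_, fun h => ?_⟩
      · obtain ⟨x, hx, rfl⟩ := Finset.mem_image.1 h
        exact (h𝓐 σ hσ𝓐).2 x hx (hi.trans (hπ'.1 x hx))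
      · obtain ⟨x, hx, rfl⟩ := Finset.mem_image.1 h
        exact hπ'.2 x hx (hi.symm.trans (hσU x hx))
      · obtain ⟨x, hx, hx'⟩ := Finset.mem_image.1 h
        have h1 : σ x.1 = σ i := by rw [hσU x hx, hx', hi]
        have h2 := σ.injective h1
        subst h2
        exact hπ'.2 x hx hx'.symm
    · exact Finset.card_image_of_injective _ fun i j h => (Prod.ext_iff.1 h).1
  have hUn : U.card ≤ n := by omega
  have hUnr : (0 : ℝ) ≤ n - U.card := by
    have : (U.card : ℝ) ≤ n := by exact_mod_cast hUn
    linarith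
  rcases lt_or_ge U.card a with hta | hta
  · -- `U` is small: all compatible rows may have to be used.
    have hpos : (0 : ℝ) < ((missing 𝓑 (U \ V)).card : ℝ) := lt_of_le_of_lt (by positivity) hdB
    obtain ⟨π, hπ⟩ := Finset.card_pos.1 (by exact_mod_cast hpos)
    obtain ⟨Z, hZU, hZ, hZc⟩ := main π hπ
    refine ⟨Z, hZU, by simp [hZ], ?_⟩
    have h1 : Z.card ≤ n - U.card := by
      rw [hZc, ← card_image_fst hU₀]
      calc _ ≤ ((U.image Prod.fst)ᶜ).card := by
            refine Finset.card_le_card fun i hi => ?_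
            rw [Finset.mem_filter] at hi
            exact Finset.mem_compl.2 hi.2.2.1
        _ = _ := by rw [Finset.card_compl, Fintype.card_fin]
    have h2 : (Z.card : ℝ) ≤ n - U.card := by
      have : (Z.card : ℝ) ≤ ((n - U.card : ℕ) : ℝ) := by exact_mod_cast h1
      rwa [Nat.cast_sub hUn] at this
    simp only [show max (U.card + 1) a = max U.card a by omega, zero_mul, add_zero]
    rw [mul_comm]
    gcongr
  · -- `U` is large: choose `π` with few rows of `U` sent into columns of `U`.
    obtain ⟨t, ht⟩ : ∃ t, t = U.card - w := ⟨_, rfl⟩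
    have hIc : t ≤ (U.image Prod.fst \ W.image Prod.fst).card := by
      have h1 := Finset.le_card_sdiff (W.image Prod.fst) (U.image Prod.fst)
      have h2 : (W.image Prod.fst).card ≤ w := Finset.card_image_le
      rw [card_image_fst hU₀] at h1
      omega
    have hJc : t ≤ (U.image Prod.snd \ W.image Prod.snd).card := by
      have h1 := Finset.le_card_sdiff (W.image Prod.snd) (U.image Prod.snd)
      have h2 : (W.image Prod.snd).card ≤ w := Finset.card_image_le
      rw [card_image_snd hU₀] at h1
      omega
    obtain ⟨I, hI, hIt⟩ := Finset.exists_subset_card_eq hIc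
    obtain ⟨J, hJ, hJt⟩ := Finset.exists_subset_card_eq hJc
    obtain ⟨π, hπ, hov⟩ := exists_small_overlap (W := W) (I := I) (J := J) (N := N) (t := t)
      (𝓑 := missing 𝓑 (U \ V)) (ε := ε) hN.symm hIt hJt (by omega) (by omega)
      (fun x hx h => (Finset.mem_sdiff.1 (hI h)).2 (Finset.mem_image_of_mem _ hx)) hε0
      (fun π hπ => (h𝓑U π hπ).1) (by rw [hN]; exact hdB)
    have ho := overlap_le_of_two_pow_le hn (by omega) (by omega) (by omega) hov
    have hcomp := card_compatible_le (h𝓑U π hπ).1 hI hJ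
    obtain ⟨Z, hZU, hZ, hZc⟩ := main π hπ
    refine ⟨Z, hZU, by simp [hZ], ?_⟩
    rw [← hZc, hIt, hJt] at hcomp
    have h1 : 7 * Z.card + 6 * U.card ≤ 6 * n := by omega
    have h2 : 7 * (Z.card : ℝ) + 6 * U.card ≤ 6 * n := by exact_mod_cast h1
    have hexp : T - max U.card a = (T - max (U.card + 1) a) + 1 := by omega
    simp only [hexp, pow_succ, zero_mul, add_zero]
    set q := (6 / 7 : ℝ) ^ (T - max (U.card + 1) a)
    have hq : 0 ≤ q := by positivity
    nlinarith

/-! ### Covers with six points -/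

theorem sqrt_two_mul_bounds (hn : 500 ≤ n) :
    31 ≤ Nat.sqrt (2 * n) ∧ Nat.sqrt (2 * n) * Nat.sqrt (2 * n) ≤ 2 * n ∧
      2 * n < (Nat.sqrt (2 * n) + 1) * (Nat.sqrt (2 * n) + 1) :=
  ⟨Nat.le_sqrt.2 (by omega), Nat.sqrt_le _, Nat.lt_succ_sqrt _⟩

/-- Branching `√(2 n)` times with the first covers gains a factor `0.57` each time. -/
theorem smallCover_sqrt (hn : 500 ≤ n) :
    SmallCover n (Nat.sqrt (2 * n)) 8 (2 / (5 * (n : ℝ) ^ 2)) (1 / (10 * (n : ℝ) ^ 2)) := by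
  obtain ⟨hk, hk1, hk2⟩ := sqrt_two_mul_bounds hn
  set k := Nat.sqrt (2 * n)
  have hn0 : (0 : ℝ) < n := by exact_mod_cast (by omega : 0 < n)
  refine (smallCover_base hn).improve (ρ := 0.57) ?_ (Nat.div_le_self _ _) (by norm_num)
    (by norm_num) (by positivity) ?_ ?_
  · rw [Nat.le_div_iff_mul_le (by norm_num)]
    nlinarith
  · have h1 : ((13 * n / 25 : ℕ) : ℝ) * 25 ≤ 13 * n := by
      exact_mod_cast Nat.div_mul_le_self (13 * n) 25
    have h2 : ((n / 12 : ℕ) : ℝ) * 12 ≤ n := by exact_mod_cast Nat.div_mul_le_self n 12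
    linarith
  · have key : ∀ m : ℕ, 31 ≤ m → (0.57 : ℝ) ^ m * ((m : ℝ) + 1) ^ 4 ≤ 0.4 := by
      intro m hm
      induction m, hm using Nat.le_induction with
      | base => norm_num
      | succ m hm ih =>
        have hm' : (31 : ℝ) ≤ m := by exact_mod_cast hm
        have h1 : (m : ℝ) + 1 + 1 ≤ (33 / 32) * (m + 1) := by linarith
        have h2 : ((m : ℝ) + 1 + 1) ^ 4 ≤ ((33 / 32) * (m + 1)) ^ 4 := by gcongr
        have h3 : (0 : ℝ) ≤ 0.57 ^ m * ((m : ℝ) + 1) ^ 4 := by positivity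
        push_cast
        calc (0.57 : ℝ) ^ (m + 1) * ((m : ℝ) + 1 + 1) ^ 4
            ≤ (0.57 : ℝ) ^ (m + 1) * ((33 / 32) * (m + 1)) ^ 4 := by gcongr
          _ = 0.57 ^ m * ((m : ℝ) + 1) ^ 4 * (0.57 * (33 / 32) ^ 4) := by ring
          _ ≤ 0.57 ^ m * ((m : ℝ) + 1) ^ 4 * 1 := by gcongr; norm_num
          _ ≤ 0.4 := by linarith
    have h1 := key k hk
    have h2 : 2 * (n : ℝ) < ((k : ℝ) + 1) * (k + 1) := by exact_mod_cast hk2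
    have h3 : (n : ℝ) ^ 2 ≤ ((k : ℝ) + 1) ^ 4 / 4 := by
      have : (2 * (n : ℝ)) ^ 2 ≤ (((k : ℝ) + 1) * (k + 1)) ^ 2 := by gcongr
      nlinarith
    have h4 : (0.57 : ℝ) ^ k * (n : ℝ) ^ 2 ≤ 0.1 := by
      have : (0.57 : ℝ) ^ k * (n : ℝ) ^ 2 ≤ 0.57 ^ k * (((k : ℝ) + 1) ^ 4 / 4) := by gcongr
      linarith
    have h5 : (0.57 : ℝ) ^ k ≤ 0.1 / (n : ℝ) ^ 2 := by
      rwa [le_div_iff₀ (by positivity)]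
    have h6 : (1 / (10 * (n : ℝ) ^ 2)) / (1 - 0.57) = (10 / 43) / (n : ℝ) ^ 2 := by
      field_simp; norm_num
    have h7 : 2 / (5 * (n : ℝ) ^ 2) = 0.4 / (n : ℝ) ^ 2 := by field_simp; norm_num
    rw [h6, h7]
    calc _ ≤ 0.1 / (n : ℝ) ^ 2 + (10 / 43) / (n : ℝ) ^ 2 := by gcongr
      _ = (0.1 + 10 / 43) / (n : ℝ) ^ 2 := by ring
      _ < _ := by gcongr; norm_num

/-- With covers of `√(2 n)` points each branching gains a factor of order `n ^ (-1 / 2)`, so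
that six of them reach the order `n ^ (-3)`. -/
theorem smallCover_six (hn : 500 ≤ n) :
    SmallCover n 6 2 (3 / (20 * (n : ℝ) ^ 2)) (2 / (5 * (n : ℝ) ^ 2)) := by
  obtain ⟨hk, hk1, hk2⟩ := sqrt_two_mul_bounds hn
  have hcov := smallCover_sqrt hn
  set k := Nat.sqrt (2 * n)
  have hn' : (500 : ℝ) ≤ n := by exact_mod_cast hn
  have hn8 : (0 : ℝ) < n - 8 := by linarith
  have hk1' : (k : ℝ) ^ 2 ≤ 2 * n := by rw [pow_two]; exact_mod_cast hk1
  set ρ : ℝ := k / (n - 8) with hρ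
  have hρ0 : 0 ≤ ρ := by positivity
  have hρ2 : ρ ^ 2 ≤ 2.1 / n := by
    rw [hρ, div_pow, div_le_div_iff₀ (by positivity) (by positivity)]
    nlinarith
  have hρn : (2.1 : ℝ) / n ≤ 0.01 := by rw [div_le_iff₀ (by positivity)]; linarith
  have hρ1 : ρ ≤ 0.1 := by nlinarith
  refine hcov.improve (ρ := ρ) (by norm_num) (by omega) hρ0 (by linarith) (by positivity) ?_ ?_
  · rw [hρ]
    push_cast
    rw [div_mul_cancel₀ _ hn8.ne']
  · have h1 : ρ ^ 6 ≤ 0.02 / (n : ℝ) ^ 2 := by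
      calc ρ ^ 6 = (ρ ^ 2) ^ 3 := by ring
        _ ≤ (2.1 / (n : ℝ)) ^ 3 := by gcongr
        _ ≤ 0.02 / (n : ℝ) ^ 2 := by
          rw [div_pow, div_le_div_iff₀ (by positivity) (by positivity)]
          have : (0 : ℝ) < (n : ℝ) ^ 2 := by positivity
          nlinarith
    have h2 : (1 / (10 * (n : ℝ) ^ 2)) / (1 - ρ) ≤ (1 / 9) / (n : ℝ) ^ 2 := by
      have h3 : (1 / 9) / (n : ℝ) ^ 2 = (1 / (10 * (n : ℝ) ^ 2)) / 0.9 := by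
        field_simp; norm_num
      rw [h3]
      gcongr
      linarith
    have h7 : 3 / (20 * (n : ℝ) ^ 2) = 0.15 / (n : ℝ) ^ 2 := by field_simp; norm_num
    rw [h7]
    calc _ ≤ 0.02 / (n : ℝ) ^ 2 + (1 / 9) / (n : ℝ) ^ 2 := by gcongr
      _ = (0.02 + 1 / 9) / (n : ℝ) ^ 2 := by ring
      _ < _ := by gcongr; norm_num

/-! ### Permutations through two points -/

theorem factorial_le_three_mul_numDerangements :
    ∀ m : ℕ, (m + 2)! ≤ 3 * numDerangements (m + 2)
  | 0 => by decide
  | 1 => by decide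
  | m + 2 => by
    have h1 := factorial_le_three_mul_numDerangements m
    have h2 := factorial_le_three_mul_numDerangements (m + 1)
    rw [numDerangements_add_two (m + 2)]
    have h3 : (m + 2 + 2)! = (m + 2 + 1) * ((m + 2)! + (m + 1 + 2)!) := by
      rw [Nat.factorial_succ (m + 2 + 1), Nat.factorial_succ (m + 2)]
      ring
    rw [h3, mul_left_comm]
    exact Nat.mul_le_mul_left _ (by rw [mul_add]; exact Nat.add_le_add h1 h2)

theorem card_agree_exactly (τ : Equiv.Perm (Fin n)) (R : Finset (Fin n)) :
    (Finset.univ.filter (fun σ : Equiv.Perm (Fin n) => ∀ a, a ∈ R ↔ σ a = τ a)).card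
      = numDerangements (n - R.card) := by
  have e : {σ : Equiv.Perm (Fin n) // ∀ a, a ∈ R ↔ σ a = τ a} ≃
      {f : Equiv.Perm (Fin n) // ∀ a, ¬ (a ∉ R) ↔ a ∈ Function.fixedPoints f} := by
    refine (Equiv.mulLeft τ⁻¹).subtypeEquiv fun σ => forall_congr' fun a => ?_
    rw [not_not, Function.mem_fixedPoints, Function.IsFixedPt, Equiv.coe_mulLeft,
      Equiv.Perm.mul_apply, Equiv.Perm.inv_eq_iff_eq]
  rw [← Fintype.card_subtype, Fintype.card_congr e,
    ← Fintype.card_congr (derangements.subtypeEquiv (fun a => a ∉ R)),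
    card_derangements_eq_numDerangements, Fintype.card_subtype_compl, Fintype.card_fin,
    Fintype.card_coe]

theorem mem_through_pair {𝓕 : Finset (Equiv.Perm (Fin n))} {y z : Fin n × Fin n}
    {σ : Equiv.Perm (Fin n)} :
    σ ∈ through 𝓕 {y, z} ↔ σ ∈ 𝓕 ∧ σ y.1 = y.2 ∧ σ z.1 = z.2 := by
  simp [mem_through]

theorem mem_missing_pair {𝓕 : Finset (Equiv.Perm (Fin n))} {y z : Fin n × Fin n}
    {σ : Equiv.Perm (Fin n)} :
    σ ∈ missing 𝓕 {y, z} ↔ σ ∈ 𝓕 ∧ σ y.1 ≠ y.2 ∧ σ z.1 ≠ z.2 := by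
  simp [mem_missing]

theorem mem_missing_singleton {𝓕 : Finset (Equiv.Perm (Fin n))} {x : Fin n × Fin n}
    {σ : Equiv.Perm (Fin n)} : σ ∈ missing 𝓕 {x} ↔ σ ∈ 𝓕 ∧ σ x.1 ≠ x.2 := by
  simp [mem_missing]

/-- Some permutation contains `x` and keeps every point of `ρ` that shares neither row nor column
with `x`. -/
theorem exists_perm_through (ρ : Equiv.Perm (Fin n)) (x : Fin n × Fin n) :
    ∃ τ : Equiv.Perm (Fin n), τ x.1 = x.2 ∧ ∀ i, i ≠ x.1 → ρ i ≠ x.2 → τ i = ρ i := by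
  refine ⟨Equiv.swap (ρ x.1) x.2 * ρ, by simp, fun i hi hi' => ?_⟩
  rw [Equiv.Perm.mul_apply]
  exact Equiv.swap_apply_of_ne_of_ne (fun h => hi (ρ.injective h)) hi'

/-- At most two thirds of the permutations through two points `y` and `z` meet a given permutation
`ρ` that contains neither. On the remaining rows `ρ` can be replaced by a permutation through `y`
and `z`, and those avoiding it there are counted by derangements. -/
theorem three_mul_card_meet_le {y z : Fin n × Fin n} (hyz : y ≠ z) (hn : 4 ≤ n)
    {ρ : Equiv.Perm (Fin n)} (hy : ρ y.1 ≠ y.2) (hz : ρ z.1 ≠ z.2) :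
    3 * ((through (Finset.univ : Finset (Equiv.Perm (Fin n))) {y, z}).filter
      (fun σ => ∃ i, σ i = ρ i)).card ≤ 2 * (n - 2)! := by
  set X := through (Finset.univ : Finset (Equiv.Perm (Fin n))) {y, z} with hX
  rcases X.eq_empty_or_nonempty with hE | ⟨σ₀, hσ₀⟩
  · simp [hE]
  rw [hX, mem_through_pair] at hσ₀
  obtain ⟨_, hσy, hσz⟩ := hσ₀
  have h1 : y.1 ≠ z.1 := fun h => hyz (Prod.ext h (by rw [← hσy, ← hσz, h]))
  have h2 : y.2 ≠ z.2 := fun h => h1 (σ₀.injective (by rw [hσy, hσz, h]))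
  obtain ⟨τ₁, hτ₁y, hτ₁⟩ := exists_perm_through ρ y
  obtain ⟨τ, hτz, hτ⟩ := exists_perm_through τ₁ z
  have hτy : τ y.1 = y.2 := by
    rw [hτ y.1 h1 (by rw [hτ₁y]; exact h2), hτ₁y]
  have hXc : X.card ≤ (n - 2)! := by
    have := card_through_le (Finset.univ : Finset (Equiv.Perm (Fin n))) {y, z}
    rwa [Finset.card_pair hyz] at this
  set R : Finset (Fin n) := {y.1, z.1} with hR
  have hRc : R.card = 2 := Finset.card_pair h1
  have hD := card_agree_exactly τ R
  rw [hRc] at hD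
  set D := Finset.univ.filter (fun σ : Equiv.Perm (Fin n) => ∀ a, a ∈ R ↔ σ a = τ a) with hDdef
  have hdisj : Disjoint (X.filter (fun σ => ∃ i, σ i = ρ i)) D := by
    rw [Finset.disjoint_left]
    intro σ hσ hσD
    rw [Finset.mem_filter, hX, mem_through_pair] at hσ
    rw [hDdef, Finset.mem_filter] at hσD
    obtain ⟨⟨_, hsy, hsz⟩, i, hi⟩ := hσ
    have hiy : i ≠ y.1 := by rintro rfl; exact hy (hi.symm.trans hsy)
    have hiz : i ≠ z.1 := by rintro rfl; exact hz (hi.symm.trans hsz)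
    have hρy : ρ i ≠ y.2 := by rw [← hi, ← hsy]; exact fun h => hiy (σ.injective h)
    have hρz : ρ i ≠ z.2 := by rw [← hi, ← hsz]; exact fun h => hiz (σ.injective h)
    have h3 : τ₁ i = ρ i := hτ₁ i hiy hρy
    have h4 : τ i = ρ i := by rw [hτ i hiz (by rwa [h3]), h3]
    have := (hσD.2 i).2 (hi.trans h4.symm)
    simp [hR, hiy, hiz] at this
  have hsub : X.filter (fun σ => ∃ i, σ i = ρ i) ∪ D ⊆ X := by
    refine Finset.union_subset (Finset.filter_subset _ _) fun σ hσ => ?_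
    rw [hDdef, Finset.mem_filter] at hσ
    rw [hX, mem_through_pair]
    refine ⟨Finset.mem_univ _, ?_, ?_⟩
    · rw [(hσ.2 y.1).1 (by simp [hR]), hτy]
    · rw [(hσ.2 z.1).1 (by simp [hR]), hτz]
  have h5 := Finset.card_le_card hsub
  rw [Finset.card_union_of_disjoint hdisj, hD] at h5
  obtain ⟨m, rfl⟩ := Nat.exists_eq_add_of_le' hn
  have h6 := factorial_le_three_mul_numDerangements (m + 2 - 2)
  have h7 : m + 4 - 2 = m + 2 - 2 + 2 := by omega
  rw [h7] at hXc h5 ⊢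
  omega

/-- The permutations through `y` and `z` but not through `x`, when the three points are
compatible. -/
theorem card_through_pair_missing {x y z : Fin n × Fin n} {τ : Equiv.Perm (Fin n)} (hn : 3 ≤ n)
    (hxy : x ≠ y) (hxz : x ≠ z) (hyz : y ≠ z)
    (hx : τ x.1 = x.2) (hy : τ y.1 = y.2) (hz : τ z.1 = z.2) :
    (missing (through (Finset.univ : Finset (Equiv.Perm (Fin n))) {y, z}) {x}).card
      = (n - 3) * (n - 3)! := by
  have h1 := card_through_univ (P := {y, z}) (τ := τ) (by simp [hy, hz])
  have h2 := card_through_univ (P := {x, y, z}) (τ := τ) (by simp [hx, hy, hz])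
  rw [Finset.card_pair hyz] at h1
  rw [Finset.card_eq_three.2 ⟨x, y, z, hxy, hxz, hyz, rfl⟩] at h2
  have h3 : missing (through (Finset.univ : Finset (Equiv.Perm (Fin n))) {y, z}) {x}
      = through Finset.univ {y, z} \ through Finset.univ {x, y, z} := by
    ext σ
    simp only [mem_missing, mem_through, Finset.mem_sdiff, Finset.mem_univ, true_and,
      Finset.mem_insert, Finset.mem_singleton, forall_eq_or_imp, forall_eq]
    tauto
  have h4 : through (Finset.univ : Finset (Equiv.Perm (Fin n))) {x, y, z}
      ⊆ through Finset.univ {y, z} := by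
    intro σ
    simp only [mem_through, Finset.mem_univ, true_and,
      Finset.mem_insert, Finset.mem_singleton, forall_eq_or_imp, forall_eq]
    tauto
  rw [h3, Finset.card_sdiff_of_subset h4, h1, h2]
  have h5 : n - 2 = (n - 3) + 1 := by omega
  rw [h5, Nat.factorial_succ]
  have : (n - 3 + 1) * (n - 3)! = (n - 3) * (n - 3)! + (n - 3)! := by ring
  omega

/-! ### Almost covering pairs -/

theorem factorial_eqs (hn : 500 ≤ n) :
    ((n - 2)! : ℝ) = (n - 2) * (n - 3)! ∧ ((n - 1)! : ℝ) = (n - 1) * ((n - 2) * (n - 3)!) ∧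
      (n ! : ℝ) = n * ((n - 1) * ((n - 2) * (n - 3)!)) := by
  obtain ⟨m, rfl⟩ := Nat.exists_eq_add_of_le' (show 3 ≤ n by omega)
  have h1 : m + 3 - 1 = m + 2 := by omega
  have h2 : m + 3 - 2 = m + 1 := by omega
  have h3 : m + 3 - 3 = m := by omega
  rw [h1, h2, h3, Nat.factorial_succ (m + 2), Nat.factorial_succ (m + 1), Nat.factorial_succ m]
  push_cast
  refine ⟨by ring, by ring, by ring⟩

/-- The proportions of the final covers, in terms of `(n - 3)!`. -/
theorem proportion_bounds (hn : 500 ≤ n) :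
    (3 / (20 * (n : ℝ) ^ 2) * n ! ≤ 0.15 * ((n - 2) * (n - 3)!)) ∧
    (2 / (5 * (n : ℝ) ^ 2) * n ! ≤ 0.4 * ((n - 2) * (n - 3)!)) ∧
    (2 / (5 * (n : ℝ) ^ 2) * (n - 1)! ≤ (n - 3)!) ∧
    (2 / (5 * (n : ℝ) ^ 2) * (n - 2)! ≤ (n - 3)!) ∧
    (3 / (20 * (n : ℝ) ^ 2) * (n - 2)! ≤ (n - 3)!) := by
  obtain ⟨h2, h1, h0⟩ := factorial_eqs hn
  have hn' : (500 : ℝ) ≤ n := by exact_mod_cast hn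
  have hM : (0 : ℝ) < (n - 3)! := by positivity
  rw [h0, h1, h2]
  generalize ((n - 3)! : ℝ) = M at hM ⊢
  have e1 : ((n : ℝ) - 1) / n ≤ 1 := by rw [div_le_one (by linarith)]; linarith
  have e2 : ((n : ℝ) - 2) / n ≤ 1 := by rw [div_le_one (by linarith)]; linarith
  have e3 : 1 / (n : ℝ) ≤ 1 := by rw [div_le_one (by linarith)]; linarith
  have p1 : 0 ≤ ((n : ℝ) - 1) / n := div_nonneg (by linarith) (by linarith)
  have p2 : 0 ≤ ((n : ℝ) - 2) / n := div_nonneg (by linarith) (by linarith)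
  have hX : 0 ≤ ((n : ℝ) - 2) * M := mul_nonneg (by linarith) hM.le
  have q1 : ((n : ℝ) - 1) / n * (((n : ℝ) - 2) * M) ≤ ((n : ℝ) - 2) * M :=
    mul_le_of_le_one_left hX e1
  have q2 : ((n : ℝ) - 1) / n * (((n : ℝ) - 2) / n) * M ≤ M :=
    mul_le_of_le_one_left hM.le (mul_le_one₀ e1 p2 e2)
  have q3 : 1 / (n : ℝ) * (((n : ℝ) - 2) / n) * M ≤ M :=
    mul_le_of_le_one_left hM.le (mul_le_one₀ e3 p2 e2)
  have hnz : (n : ℝ) ≠ 0 := by linarith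
  refine ⟨?_, ?_, ?_, ?_, ?_⟩
  · calc _ = 0.15 * (((n : ℝ) - 1) / n * (((n : ℝ) - 2) * M)) := by field_simp; ring
      _ ≤ _ := by linarith
  · calc _ = 0.4 * (((n : ℝ) - 1) / n * (((n : ℝ) - 2) * M)) := by field_simp; ring
      _ ≤ _ := by linarith
  · calc _ = 0.4 * (((n : ℝ) - 1) / n * (((n : ℝ) - 2) / n) * M) := by field_simp; ring
      _ ≤ _ := by linarith
  · calc _ = 0.4 * (1 / (n : ℝ) * (((n : ℝ) - 2) / n) * M) := by field_simp; ring
      _ ≤ _ := by linarith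
  · calc _ = 0.15 * (1 / (n : ℝ) * (((n : ℝ) - 2) / n) * M) := by field_simp; ring
      _ ≤ _ := by linarith

/-- All but a small multiple of `n! / n ^ 2` of the members of `𝓕` meet `P`. -/
def AlmostCovers (𝓕 : Finset (Equiv.Perm (Fin n))) (P : Finset (Fin n × Fin n)) : Prop :=
  ((missing 𝓕 P).card : ℝ) < 3 / (20 * (n : ℝ) ^ 2) * n !

theorem exists_cover_of_not_almostCovers (hn : 500 ≤ n) {𝓕 : Finset (Equiv.Perm (Fin n))}
    (h𝓕 : CrossIntersecting 𝓕 𝓕) {W : Finset (Fin n × Fin n)} (hW : W.card ≤ 2)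
    (hdense : ¬ AlmostCovers 𝓕 W) :
    ∃ Z : Finset (Fin n × Fin n), Z.card ≤ 6 ∧ Disjoint Z W ∧
      ((missing (through 𝓕 W) Z).card : ℝ) ≤ 2 / (5 * (n : ℝ) ^ 2) * (n - W.card)! := by
  refine smallCover_six hn ∅ W (missing 𝓕 W) (through 𝓕 W) (by simp) hW ?_ ?_ ?_ ?_
  · exact fun σ hσ => ⟨by simp, (mem_missing.1 hσ).2⟩
  · exact fun σ hσ => ⟨(mem_through.1 hσ).2, by simp⟩
  · exact fun σ hσ π hπ => h𝓕 σ (missing_subset _ _ hσ) π (through_subset _ _ hπ)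
  · simpa [AlmostCovers] using hdense

/-- Members through `{z, w}` that meet six further points, up to a proportion `2 / (5 n ^ 2)`. -/
theorem card_le_of_six_cover (hn : 500 ≤ n) {𝓑 : Finset (Equiv.Perm (Fin n))}
    {z w : Fin n × Fin n} (hzw : z ≠ w) (h𝓑 : ∀ π ∈ 𝓑, ∀ x ∈ ({z, w} : Finset _), π x.1 = x.2)
    {Z : Finset (Fin n × Fin n)} (hZ : Z.card ≤ 6) (hZW : Disjoint Z {z, w})
    (hmiss : ((missing 𝓑 Z).card : ℝ) ≤ 2 / (5 * (n : ℝ) ^ 2) * (n - 2)!) :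
    (𝓑.card : ℝ) ≤ 7 * (n - 3)! := by
  have h1 : (𝓑.card : ℝ) ≤ (missing 𝓑 Z).card + ∑ x ∈ Z, ((through 𝓑 {x}).card : ℝ) := by
    exact_mod_cast card_le_missing_add_sum 𝓑 Z
  have h2 : ∑ x ∈ Z, ((through 𝓑 {x}).card : ℝ) ≤ ∑ _x ∈ Z, ((n - 3)! : ℝ) := by
    refine Finset.sum_le_sum fun x hx => ?_
    have hx' : x ∉ ({z, w} : Finset _) := Finset.disjoint_left.1 hZW hx
    have h3 := card_through_le 𝓑 ({z, w} ∪ {x})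
    rw [← through_through, through_eq_self h𝓑, Finset.union_comm, ← Finset.insert_eq,
      Finset.card_insert_of_notMem hx', Finset.card_pair hzw] at h3
    exact_mod_cast h3
  rw [Finset.sum_const, nsmul_eq_mul] at h2
  have h3 : (Z.card : ℝ) ≤ 6 := by exact_mod_cast hZ
  have h4 : (Z.card : ℝ) * (n - 3)! ≤ 6 * (n - 3)! := by gcongr
  have h5 := (proportion_bounds hn).2.2.2.1
  linarith

section LargeDiversity

variable {𝓕 : Finset (Equiv.Perm (Fin n))}

theorem lt_card_missing (hdiv : ∀ x, (n - 3) * (n - 3)! < (missing 𝓕 {x}).card) (hn : 500 ≤ n)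
    (x : Fin n × Fin n) : ((n : ℝ) - 3) * (n - 3)! < (missing 𝓕 {x}).card := by
  have h : (((n - 3) * (n - 3)! : ℕ) : ℝ) < (missing 𝓕 {x}).card := by exact_mod_cast hdiv x
  rw [Nat.cast_mul, Nat.cast_sub (by omega)] at h
  exact_mod_cast h

/-- Almost covering pairs exist and have no common point. Otherwise let `x` be common to all of
them: two rounds of covers place the members avoiding `x`, up to few exceptions, on `36` pairs, and
each pair is either almost covering and contains `x`, or is met by a third cover and so carries
few members. -/
theorem exists_almostCovers_pair (hn : 500 ≤ n) (h𝓕 : CrossIntersecting 𝓕 𝓕)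
    (hdiv : ∀ x, (n - 3) * (n - 3)! < (missing 𝓕 {x}).card) (x : Fin n × Fin n) :
    ∃ z w, z ≠ w ∧ x ≠ z ∧ x ≠ w ∧ AlmostCovers 𝓕 {z, w} := by
  by_contra! hno
  have hn' : (500 : ℝ) ≤ n := by exact_mod_cast hn
  obtain ⟨hp0, hp1, hp2, hp3, hp4⟩ := proportion_bounds hn
  have hM : (0 : ℝ) < (n - 3)! := by positivity
  have hdense1 : ∀ z, ¬ AlmostCovers 𝓕 {z} := by
    intro z hz
    have := lt_card_missing hdiv hn z
    unfold AlmostCovers at hz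
    nlinarith
  have hdense0 : ¬ AlmostCovers 𝓕 ∅ := by
    intro h
    refine hdense1 x (lt_of_le_of_lt ?_ h)
    have : missing 𝓕 {x} ⊆ missing 𝓕 ∅ := by
      intro σ; simp only [mem_missing]; exact fun h => ⟨h.1, by simp⟩
    exact_mod_cast Finset.card_le_card this
  obtain ⟨Z, hZ, _, hZm⟩ := exists_cover_of_not_almostCovers hn h𝓕 (W := ∅) (by simp) hdense0
  have hcov : ∀ z, ∃ Z' : Finset (Fin n × Fin n), Z'.card ≤ 6 ∧ Disjoint Z' {z} ∧
      ((missing (through 𝓕 {z}) Z').card : ℝ) ≤ 2 / (5 * (n : ℝ) ^ 2) * (n - 1)! := by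
    intro z
    simpa using exists_cover_of_not_almostCovers hn h𝓕 (W := {z}) (by simp) (hdense1 z)
  choose Y hY hYd hYm using hcov
  set 𝓖 := missing 𝓕 {x} with h𝓖
  have h𝓖𝓕 : 𝓖 ⊆ 𝓕 := missing_subset _ _
  have hpair : ∀ z, ∀ w ∈ Y z, ((through (through 𝓖 {z}) {w}).card : ℝ) ≤ 7 * (n - 3)! := by
    intro z w hw
    have hzw : z ≠ w := by
      rintro rfl
      exact Finset.disjoint_left.1 (hYd z) hw (Finset.mem_singleton_self _)
    rw [through_through, ← Finset.insert_eq]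
    by_cases hx : x = z ∨ x = w
    · have : through 𝓖 {z, w} = ∅ := by
        rw [Finset.eq_empty_iff_forall_notMem]
        intro σ hσ
        rw [mem_through_pair, h𝓖, mem_missing_singleton] at hσ
        rcases hx with rfl | rfl
        · exact hσ.1.2 hσ.2.1
        · exact hσ.1.2 hσ.2.2
      rw [this]
      simp only [Finset.card_empty, Nat.cast_zero]
      positivity
    · push Not at hx
      obtain ⟨X, hX, hXd, hXm⟩ := exists_cover_of_not_almostCovers hn h𝓕 (W := {z, w})
        Finset.card_le_two (hno z w hzw hx.1 hx.2)
      rw [Finset.card_pair hzw] at hXm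
      have h1 := card_le_of_six_cover hn hzw (fun π hπ => (mem_through.1 hπ).2) hX hXd hXm
      refine le_trans ?_ h1
      exact_mod_cast Finset.card_le_card (Finset.filter_subset_filter _ h𝓖𝓕)
  have hsingle : ∀ z, ((through 𝓖 {z}).card : ℝ) ≤ 43 * (n - 3)! := by
    intro z
    have h1 : ((through 𝓖 {z}).card : ℝ) ≤ (missing (through 𝓖 {z}) (Y z)).card
        + ∑ w ∈ Y z, ((through (through 𝓖 {z}) {w}).card : ℝ) := by
      exact_mod_cast card_le_missing_add_sum (through 𝓖 {z}) (Y z)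
    have h2 := Finset.sum_le_sum (hpair z)
    rw [Finset.sum_const, nsmul_eq_mul] at h2
    have h3 : ((Y z).card : ℝ) ≤ 6 := by exact_mod_cast hY z
    have h4 : ((Y z).card : ℝ) * (7 * (n - 3)!) ≤ 6 * (7 * (n - 3)!) := by gcongr
    have h5 : ((missing (through 𝓖 {z}) (Y z)).card : ℝ)
        ≤ (missing (through 𝓕 {z}) (Y z)).card := by
      exact_mod_cast Finset.card_le_card
        (Finset.filter_subset_filter _ (Finset.filter_subset_filter _ h𝓖𝓕))
    linarith [hYm z]
  have h1 : (𝓖.card : ℝ) ≤ (missing 𝓖 Z).card + ∑ z ∈ Z, ((through 𝓖 {z}).card : ℝ) := by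
    exact_mod_cast card_le_missing_add_sum 𝓖 Z
  have h2 : ∑ z ∈ Z, ((through 𝓖 {z}).card : ℝ) ≤ ∑ _z ∈ Z, (43 * (n - 3)! : ℝ) :=
    Finset.sum_le_sum fun z _ => hsingle z
  rw [Finset.sum_const, nsmul_eq_mul] at h2
  have h3 : (Z.card : ℝ) ≤ 6 := by exact_mod_cast hZ
  have h4 : (Z.card : ℝ) * (43 * (n - 3)!) ≤ 6 * (43 * (n - 3)!) := by gcongr
  have h5 : ((missing 𝓖 Z).card : ℝ) ≤ 2 / (5 * (n : ℝ) ^ 2) * n ! := by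
    have h6 : missing 𝓖 Z ⊆ missing (through 𝓕 ∅) Z := by
      refine Finset.filter_subset_filter _ fun σ hσ => ?_
      exact mem_through.2 ⟨h𝓖𝓕 hσ, by simp⟩
    have h7 : ((missing 𝓖 Z).card : ℝ) ≤ (missing (through 𝓕 ∅) Z).card := by
      exact_mod_cast Finset.card_le_card h6
    simpa using h7.trans hZm
  have h6 := lt_card_missing hdiv hn x
  rw [← h𝓖] at h6
  nlinarith

/-- Of the members on `{p, q}` off `{r, s}` and those on `{r, s}` off `{p, q}`, one part is
negligible: if the first is dense then six further points nearly cover the second. -/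
theorem card_through_pair_off_pair_le (hn : 500 ≤ n) (h𝓕 : CrossIntersecting 𝓕 𝓕)
    {p q r s : Fin n × Fin n} (hrs : r ≠ s) (hpq : p ≠ q) :
    ((missing (through 𝓕 {p, q}) {r, s}).card : ℝ) ≤ 7 * (n - 3)! ∨
      ((missing (through 𝓕 {r, s}) {p, q}).card : ℝ) ≤ 7 * (n - 3)! := by
  have hM : (0 : ℝ) < (n - 3)! := by positivity
  by_cases hd : 3 / (20 * (n : ℝ) ^ 2) * (n - 2)! ≤ (missing (through 𝓕 {p, q}) {r, s}).card
  · right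
    have hpq2 := Finset.card_pair hpq
    have hrs2 := Finset.card_pair hrs
    obtain ⟨Z, hZ, hZW, hZm⟩ := smallCover_six hn {p, q} {r, s}
      (missing (through 𝓕 {p, q}) {r, s}) (missing (through 𝓕 {r, s}) {p, q})
      hpq2.le hrs2.le
      (fun σ hσ => ⟨(mem_through.1 (mem_missing.1 hσ).1).2, (mem_missing.1 hσ).2⟩)
      (fun σ hσ => ⟨(mem_through.1 (mem_missing.1 hσ).1).2, (mem_missing.1 hσ).2⟩)
      (fun σ hσ π hπ => h𝓕 σ (through_subset _ _ (missing_subset _ _ hσ)) π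
        (through_subset _ _ (missing_subset _ _ hπ)))
      (by rwa [hpq2])
    rw [hrs2] at hZm
    exact card_le_of_six_cover hn hrs
      (fun π hπ => (mem_through.1 (mem_missing.1 hπ).1).2) hZ hZW hZm
  · left
    push Not at hd
    have := (proportion_bounds hn).2.2.2.2
    linarith

/-- With two disjoint almost covering pairs `{x, y}` and `{z, w}`, almost every member avoiding `x`
contains `y` and one of `z`, `w`. -/
theorem card_missing_le_of_disjoint_pairs (hn : 500 ≤ n) {x y z w : Fin n × Fin n}
    (hyz : y ≠ z) (hyw : y ≠ w) (hzw : z ≠ w)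
    (h1 : AlmostCovers 𝓕 {x, y}) (h2 : AlmostCovers 𝓕 {z, w}) :
    ((missing 𝓕 {x}).card : ℝ) ≤ 0.3 * ((n - 2) * (n - 3)!) + 2 * (n - 3)!
      + (missing (through 𝓕 {y, z}) {x, w}).card + (missing (through 𝓕 {y, w}) {x, z}).card := by
  have hsub : missing 𝓕 {x} ⊆ missing 𝓕 {x, y} ∪ (missing 𝓕 {z, w} ∪
      (through 𝓕 {y, z, w} ∪ (missing (through 𝓕 {y, z}) {x, w} ∪
        missing (through 𝓕 {y, w}) {x, z}))) := by
    intro σ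
    simp only [Finset.mem_union, mem_missing, mem_through, Finset.mem_insert,
      Finset.mem_singleton, forall_eq_or_imp, forall_eq]
    tauto
  have h3 : (through 𝓕 {y, z, w}).card ≤ (n - 3)! := by
    have := card_through_le 𝓕 {y, z, w}
    rwa [Finset.card_eq_three.2 ⟨y, z, w, hyz, hyw, hzw, rfl⟩] at this
  have h4 := Finset.card_le_card hsub
  have h5 := Finset.card_union_le (missing 𝓕 {x, y}) (missing 𝓕 {z, w} ∪
      (through 𝓕 {y, z, w} ∪ (missing (through 𝓕 {y, z}) {x, w} ∪
        missing (through 𝓕 {y, w}) {x, z})))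
  have h6 := Finset.card_union_le (missing 𝓕 {z, w})
      (through 𝓕 {y, z, w} ∪ (missing (through 𝓕 {y, z}) {x, w} ∪
        missing (through 𝓕 {y, w}) {x, z}))
  have h7 := Finset.card_union_le (through 𝓕 {y, z, w})
    (missing (through 𝓕 {y, z}) {x, w} ∪ missing (through 𝓕 {y, w}) {x, z})
  have h8 := Finset.card_union_le (missing (through 𝓕 {y, z}) {x, w})
    (missing (through 𝓕 {y, w}) {x, z})
  have h9 : (missing 𝓕 {x}).card ≤ (missing 𝓕 {x, y}).card + (missing 𝓕 {z, w}).card + (n - 3)!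
      + (missing (through 𝓕 {y, z}) {x, w}).card
      + (missing (through 𝓕 {y, w}) {x, z}).card := by omega
  have h10 : ((missing 𝓕 {x}).card : ℝ) ≤ (missing 𝓕 {x, y}).card + (missing 𝓕 {z, w}).card
      + (n - 3)! + (missing (through 𝓕 {y, z}) {x, w}).card
      + (missing (through 𝓕 {y, w}) {x, z}).card := by exact_mod_cast h9
  unfold AlmostCovers at h1 h2
  have h11 := (proportion_bounds hn).1
  have hM : (0 : ℝ) < (n - 3)! := by positivity
  linarith

/-- Two disjoint almost covering pairs leave four parts of `𝓕`, and of each two opposite ones one is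
negligible. The two remaining parts share a point, which almost no member avoids. -/
theorem not_disjoint_almostCovers (hn : 500 ≤ n) (h𝓕 : CrossIntersecting 𝓕 𝓕)
    (hdiv : ∀ x, (n - 3) * (n - 3)! < (missing 𝓕 {x}).card) {x y z w : Fin n × Fin n}
    (hxy : x ≠ y) (hzw : z ≠ w) (hxz : x ≠ z) (hxw : x ≠ w) (hyz : y ≠ z) (hyw : y ≠ w)
    (h1 : AlmostCovers 𝓕 {x, y}) (h2 : AlmostCovers 𝓕 {z, w}) : False := by
  have hn' : (500 : ℝ) ≤ n := by exact_mod_cast hn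
  have hM : (0 : ℝ) < (n - 3)! := by positivity
  have h1' : AlmostCovers 𝓕 {y, x} := by rwa [Finset.pair_comm]
  have h2' : AlmostCovers 𝓕 {w, z} := by rwa [Finset.pair_comm]
  have bx := card_missing_le_of_disjoint_pairs hn hyz hyw hzw h1 h2
  have b_y := card_missing_le_of_disjoint_pairs hn hxz hxw hzw h1' h2
  have bz := card_missing_le_of_disjoint_pairs hn hxw.symm hyw.symm hxy h2 h1
  have bw := card_missing_le_of_disjoint_pairs hn hxz.symm hyz.symm hxy h2' h1
  rw [Finset.pair_comm w x, Finset.pair_comm w y, Finset.pair_comm z y, Finset.pair_comm z x] at bz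
  rw [Finset.pair_comm z x, Finset.pair_comm z y, Finset.pair_comm w y, Finset.pair_comm w x] at bw
  have lx := lt_card_missing hdiv hn x
  have ly := lt_card_missing hdiv hn y
  have lz := lt_card_missing hdiv hn z
  have lw := lt_card_missing hdiv hn w
  have hfin : 0.3 * (((n : ℝ) - 2) * (n - 3)!) + 16 * (n - 3)! < ((n : ℝ) - 3) * (n - 3)! := by
    nlinarith
  rcases card_through_pair_off_pair_le hn h𝓕 (p := x) (q := z) (r := y) (s := w) hyw hxz with
    h | h <;>
  rcases card_through_pair_off_pair_le hn h𝓕 (p := x) (q := w) (r := y) (s := z) hyz hxw with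
    h' | h' <;> linarith

/-- If `{x, y}` and `{x, z}` are almost covering and the members avoiding `x` are numerous, then no
member avoids both `y` and `z`: it would be met by all members through `y` and `z`. -/
theorem not_mem_missing_of_almostCovers (hn : 500 ≤ n) (h𝓕 : CrossIntersecting 𝓕 𝓕)
    (hdiv : ∀ x, (n - 3) * (n - 3)! < (missing 𝓕 {x}).card) {x y z : Fin n × Fin n}
    (hyz : y ≠ z) (h1 : AlmostCovers 𝓕 {x, y}) (h2 : AlmostCovers 𝓕 {x, z})
    {ρ : Equiv.Perm (Fin n)} (hρ : ρ ∈ 𝓕) : ρ y.1 = y.2 ∨ ρ z.1 = z.2 := by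
  by_contra! hno
  have hn' : (500 : ℝ) ≤ n := by exact_mod_cast hn
  have hM : (0 : ℝ) < (n - 3)! := by positivity
  have hmeet := three_mul_card_meet_le hyz (by omega) hno.1 hno.2
  set X := (through (Finset.univ : Finset (Equiv.Perm (Fin n))) {y, z}).filter
      (fun σ => ∃ i, σ i = ρ i) with hX
  have hsub : missing 𝓕 {x} ⊆ missing 𝓕 {x, y} ∪ (missing 𝓕 {x, z} ∪ X) := by
    intro σ hσ
    rw [mem_missing_singleton] at hσ
    by_cases hy : σ y.1 = y.2
    · by_cases hz : σ z.1 = z.2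
      · refine Finset.mem_union_right _ (Finset.mem_union_right _ ?_)
        rw [hX, Finset.mem_filter, mem_through_pair]
        exact ⟨⟨Finset.mem_univ _, hy, hz⟩, h𝓕 σ hσ.1 ρ hρ⟩
      · exact Finset.mem_union_right _ (Finset.mem_union_left _
          (mem_missing_pair.2 ⟨hσ.1, hσ.2, hz⟩))
    · exact Finset.mem_union_left _ (mem_missing_pair.2 ⟨hσ.1, hσ.2, hy⟩)
  have h3 := Finset.card_le_card hsub
  have h4 := Finset.card_union_le (missing 𝓕 {x, y}) (missing 𝓕 {x, z} ∪ X)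
  have h5 := Finset.card_union_le (missing 𝓕 {x, z}) X
  have h6 : ((missing 𝓕 {x}).card : ℝ) ≤ (missing 𝓕 {x, y}).card + (missing 𝓕 {x, z}).card
      + X.card := by exact_mod_cast (by omega : (missing 𝓕 {x}).card ≤ (missing 𝓕 {x, y}).card
        + (missing 𝓕 {x, z}).card + X.card)
  have h7 : 3 * (X.card : ℝ) ≤ 2 * (n - 2)! := by exact_mod_cast hmeet
  rw [(factorial_eqs hn).1] at h7
  have h8 := (proportion_bounds hn).1
  have h9 := lt_card_missing hdiv hn x
  unfold AlmostCovers at h1 h2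
  nlinarith

/-- A triangle of almost covering pairs forces every member to contain two of the three points,
and then the family has at most the diversity of the triangle family. -/
theorem not_triangle_almostCovers (hn : 500 ≤ n) (h𝓕 : CrossIntersecting 𝓕 𝓕)
    (hdiv : ∀ x, (n - 3) * (n - 3)! < (missing 𝓕 {x}).card) {x y z : Fin n × Fin n}
    (hxy : x ≠ y) (hxz : x ≠ z) (hyz : y ≠ z) (h1 : AlmostCovers 𝓕 {x, y})
    (h2 : AlmostCovers 𝓕 {x, z}) (h3 : AlmostCovers 𝓕 {y, z}) : False := by
  have h1' : AlmostCovers 𝓕 {y, x} := by rwa [Finset.pair_comm]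
  have h2' : AlmostCovers 𝓕 {z, x} := by rwa [Finset.pair_comm]
  have h3' : AlmostCovers 𝓕 {z, y} := by rwa [Finset.pair_comm]
  have hx : ∀ ρ ∈ 𝓕, ρ y.1 = y.2 ∨ ρ z.1 = z.2 := fun ρ hρ =>
    not_mem_missing_of_almostCovers hn h𝓕 hdiv hyz h1 h2 hρ
  have hy : ∀ ρ ∈ 𝓕, ρ x.1 = x.2 ∨ ρ z.1 = z.2 := fun ρ hρ =>
    not_mem_missing_of_almostCovers hn h𝓕 hdiv hxz h1' h3 hρ
  have hz : ∀ ρ ∈ 𝓕, ρ x.1 = x.2 ∨ ρ y.1 = y.2 := fun ρ hρ =>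
    not_mem_missing_of_almostCovers hn h𝓕 hdiv hxy h2' h3' hρ
  have hne : ∀ p : Fin n × Fin n, ∃ σ ∈ 𝓕, σ p.1 ≠ p.2 := by
    intro p
    obtain ⟨σ, hσ⟩ := Finset.card_pos.1 (lt_of_le_of_lt (Nat.zero_le _) (hdiv p))
    exact ⟨σ, (mem_missing_singleton.1 hσ).1, (mem_missing_singleton.1 hσ).2⟩
  -- Members through each pair exist, so the three points are compatible.
  obtain ⟨σ₁, hσ₁, hσ₁x⟩ := hne x
  obtain ⟨σ₂, hσ₂, hσ₂y⟩ := hne y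
  obtain ⟨σ₃, hσ₃, hσ₃z⟩ := hne z
  have a1 := (hz σ₁ hσ₁).resolve_left hσ₁x
  have a2 := (hy σ₁ hσ₁).resolve_left hσ₁x
  have b1 := (hz σ₂ hσ₂).resolve_right hσ₂y
  have b2 := (hx σ₂ hσ₂).resolve_left hσ₂y
  have c1 := (hy σ₃ hσ₃).resolve_right hσ₃z
  have c2 := (hx σ₃ hσ₃).resolve_right hσ₃z
  have rows : ∀ {p q : Fin n × Fin n} {σ : Equiv.Perm (Fin n)}, p ≠ q → σ p.1 = p.2 →
      σ q.1 = q.2 → q.1 ≠ p.1 ∧ q.2 ≠ p.2 := by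
    intro p q σ hpq hp hq
    refine ⟨fun h => hpq (Prod.ext h.symm (by rw [← hp, ← hq, h])), fun h => hpq ?_⟩
    exact Prod.ext (σ.injective (by rw [hp, hq, h])) h.symm
  obtain ⟨τ, hτx, hτ⟩ := exists_perm_through σ₁ x
  have ry := rows hxy c1 c2
  have rz := rows hxz b1 b2
  have hτy : τ y.1 = y.2 := by rw [hτ y.1 ry.1 (by rw [a1]; exact ry.2), a1]
  have hτz : τ z.1 = z.2 := by rw [hτ z.1 rz.1 (by rw [a2]; exact rz.2), a2]
  have hsub : missing 𝓕 {x} ⊆ missing (through Finset.univ {y, z}) {x} := by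
    intro σ hσ
    rw [mem_missing_singleton] at hσ ⊢
    refine ⟨mem_through_pair.2 ⟨Finset.mem_univ _, ?_, ?_⟩, hσ.2⟩
    · exact (hz σ hσ.1).resolve_left hσ.2
    · exact (hy σ hσ.1).resolve_left hσ.2
  have h4 := Finset.card_le_card hsub
  rw [card_through_pair_missing (by omega) hxy hxz hyz hτx hτy hτz] at h4
  exact absurd (hdiv x) (not_lt.2 h4)

end LargeDiversity

/-- The diversity bound, in terms of the numbers of members avoiding a point. -/
theorem exists_card_missing_le (hn : 500 ≤ n) {𝓕 : Finset (Equiv.Perm (Fin n))}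
    (h𝓕 : CrossIntersecting 𝓕 𝓕) : ∃ x, (missing 𝓕 {x}).card ≤ (n - 3) * (n - 3)! := by
  by_contra! hdiv
  have x₀ : Fin n × Fin n := (⟨0, by omega⟩, ⟨0, by omega⟩)
  obtain ⟨x, y, hxy, -, -, h1⟩ := exists_almostCovers_pair hn h𝓕 hdiv x₀
  obtain ⟨p, q, hpq, hxp, hxq, h2⟩ := exists_almostCovers_pair hn h𝓕 hdiv x
  obtain ⟨r, s, hrs, hyr, hys, h3⟩ := exists_almostCovers_pair hn h𝓕 hdiv y
  -- The pair avoiding `x` contains `y`, and the pair avoiding `y` contains `x`.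
  obtain ⟨u, hyu, hxu, h2'⟩ : ∃ u, y ≠ u ∧ x ≠ u ∧ AlmostCovers 𝓕 {y, u} := by
    by_cases hp : y = p
    · exact ⟨q, hp ▸ hpq, hxq, hp ▸ h2⟩
    by_cases hq : y = q
    · exact ⟨p, hp, hxp, by rw [hq, Finset.pair_comm]; exact h2⟩
    exact (not_disjoint_almostCovers hn h𝓕 hdiv hxy hpq hxp hxq hp hq h1 h2).elim
  obtain ⟨v, hxv, hyv, h3'⟩ : ∃ v, x ≠ v ∧ y ≠ v ∧ AlmostCovers 𝓕 {x, v} := by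
    by_cases hr : x = r
    · exact ⟨s, hr ▸ hrs, hys, hr ▸ h3⟩
    by_cases hs : x = s
    · exact ⟨r, hr, hyr, by rw [hs, Finset.pair_comm]; exact h3⟩
    exact (not_disjoint_almostCovers hn h𝓕 hdiv hxy hrs hr hs hyr hys h1 h3).elim
  by_cases huv : u = v
  · subst huv
    exact not_triangle_almostCovers hn h𝓕 hdiv hxy hxv hyu h1 h3' h2'
  · exact not_disjoint_almostCovers hn h𝓕 hdiv hyu hxv hxy.symm hyv hxu.symm huv h2' h3'

/-! ### The triangle family -/

theorem mem_permEdge {σ : Equiv.Perm (Fin n)} {x : Fin n × Fin n} :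
    x ∈ permEdge σ ↔ σ x.1 = x.2 := by
  simp only [permEdge, Finset.mem_image, Finset.mem_univ, true_and]
  constructor
  · rintro ⟨i, rfl⟩
    rfl
  · exact fun h => ⟨x.1, Prod.ext rfl h⟩

theorem permEdge_injective : Function.Injective (permEdge (n := n)) := by
  intro σ π h
  ext i
  have : (i, σ i) ∈ permEdge π := by rw [← h, mem_permEdge]
  rw [mem_permEdge] at this
  exact congrArg Fin.val this.symm

theorem permDiversity_eq (𝓕 : Finset (Equiv.Perm (Fin n))) :
    permDiversity 𝓕 = ⨅ x : Fin n × Fin n, (missing 𝓕 {x}).card := by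
  unfold permDiversity setDiversity
  congr 1
  funext x
  rw [Finset.filter_image, Finset.card_image_of_injective _ permEdge_injective]
  congr 1
  ext σ
  rw [Finset.mem_filter, mem_permEdge, mem_missing_singleton]

theorem two_le_card_filter_triple {α : Type*} [DecidableEq α] {a b c : α} (hab : a ≠ b)
    (hac : a ≠ c) (hbc : b ≠ c) (p : α → Prop) [DecidablePred p] :
    2 ≤ (({a, b, c} : Finset α).filter p).card ↔ (p a ∧ p b) ∨ (p a ∧ p c) ∨ (p b ∧ p c) := by
  by_cases ha : p a <;> by_cases hb : p b <;> by_cases hc : p c <;>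
    simp [Finset.filter_insert, Finset.filter_singleton, ha, hb, hc, hab, hac, hbc]

/-- Exchanging two rows shows that a row and column foreign to `x`, `y`, `z` are not used by more
than half of the permutations through `y` and `z` but not `x`. -/
theorem card_le_two_mul_card_missing {x y z p : Fin n × Fin n}
    (h1 : x.1 ≠ y.1) (h2 : x.1 ≠ z.1) (hp1 : p.1 ≠ x.1) (hp2 : p.1 ≠ y.1)
    (hp3 : p.1 ≠ z.1) (hpx : p.2 ≠ x.2) :
    (missing (through (Finset.univ : Finset (Equiv.Perm (Fin n))) {y, z}) {x}).card
      ≤ 2 * (missing (missing (through Finset.univ {y, z}) {x}) {p}).card := by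
  set A := missing (through (Finset.univ : Finset (Equiv.Perm (Fin n))) {y, z}) {x} with hA
  have hle : (through A {p}).card ≤ (missing A {p}).card := by
    refine Finset.card_le_card_of_injOn (fun σ => σ * Equiv.swap x.1 p.1) ?_ ?_
    · intro σ hσ
      have hσ' : σ ∈ through A {p} := hσ
      rw [mem_through, hA, mem_missing_singleton, mem_through_pair] at hσ'
      obtain ⟨⟨⟨_, hy, hz⟩, hx⟩, hp⟩ := hσ'
      have hp' : σ p.1 = p.2 := hp p (Finset.mem_singleton_self _)
      change σ * Equiv.swap x.1 p.1 ∈ missing A {p}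
      rw [mem_missing_singleton, hA, mem_missing_singleton, mem_through_pair]
      refine ⟨⟨⟨Finset.mem_univ _, ?_, ?_⟩, ?_⟩, ?_⟩
      · rw [Equiv.Perm.mul_apply, Equiv.swap_apply_of_ne_of_ne h1.symm hp2.symm, hy]
      · rw [Equiv.Perm.mul_apply, Equiv.swap_apply_of_ne_of_ne h2.symm hp3.symm, hz]
      · rw [Equiv.Perm.mul_apply, Equiv.swap_apply_left, hp']
        exact hpx
      · rw [Equiv.Perm.mul_apply, Equiv.swap_apply_right, ← hp']
        exact fun h => hp1 (σ.injective h).symm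
    · intro σ _ π _ h
      exact mul_right_cancel h
  have h3 : A.card ≤ (missing A {p}).card + (through A {p}).card := by
    simpa using card_le_missing_add_sum A {p}
  omega

section TwoOfThree

variable {x y z : Fin n × Fin n} {τ : Equiv.Perm (Fin n)} {𝓣 : Finset (Equiv.Perm (Fin n))}

theorem le_card_missing_of_shared (hn : 3 ≤ n) (hxy : x ≠ y) (hxz : x ≠ z) (hyz : y ≠ z)
    (hx : τ x.1 = x.2) (hy : τ y.1 = y.2) (hz : τ z.1 = z.2)
    (h𝓣 : ∀ σ, σ ∈ 𝓣 ↔ (σ x.1 = x.2 ∧ σ y.1 = y.2) ∨ (σ x.1 = x.2 ∧ σ z.1 = z.2) ∨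
      (σ y.1 = y.2 ∧ σ z.1 = z.2)) {p : Fin n × Fin n} (hp : p.1 = x.1 ∨ p.2 = x.2) :
    (n - 3) * (n - 3)! ≤ (missing 𝓣 {p}).card := by
  by_cases hpx : p = x
  · subst hpx
    rw [← card_through_pair_missing hn hxy hxz hyz hx hy hz]
    refine Finset.card_le_card fun σ hσ => ?_
    rw [mem_missing_singleton, mem_through_pair] at hσ
    rw [mem_missing_singleton, h𝓣]
    exact ⟨Or.inr (Or.inr hσ.1.2), hσ.2⟩
  · rw [← card_through_pair_missing hn hxy.symm hyz hxz hy hx hz]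
    refine Finset.card_le_card fun σ hσ => ?_
    rw [mem_missing_singleton, mem_through_pair] at hσ
    rw [mem_missing_singleton, h𝓣]
    refine ⟨Or.inr (Or.inl hσ.1.2), fun h => hpx ?_⟩
    rcases hp with h' | h'
    · exact Prod.ext h' (by rw [← h, ← hσ.1.2.1, h'])
    · exact Prod.ext (σ.injective (by rw [h, hσ.1.2.1, h'])) h'

theorem le_card_missing (hn : 3 ≤ n) (hxy : x ≠ y) (hxz : x ≠ z) (hyz : y ≠ z)
    (hx : τ x.1 = x.2) (hy : τ y.1 = y.2) (hz : τ z.1 = z.2)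
    (h𝓣 : ∀ σ, σ ∈ 𝓣 ↔ (σ x.1 = x.2 ∧ σ y.1 = y.2) ∨ (σ x.1 = x.2 ∧ σ z.1 = z.2) ∨
      (σ y.1 = y.2 ∧ σ z.1 = z.2)) (p : Fin n × Fin n) :
    (n - 3) * (n - 3)! ≤ (missing 𝓣 {p}).card := by
  by_cases hpx : p.1 = x.1 ∨ p.2 = x.2
  · exact le_card_missing_of_shared hn hxy hxz hyz hx hy hz h𝓣 hpx
  by_cases hpy : p.1 = y.1 ∨ p.2 = y.2
  · exact le_card_missing_of_shared hn hxy.symm hyz hxz hy hx hz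
      (fun σ => by rw [h𝓣]; tauto) hpy
  by_cases hpz : p.1 = z.1 ∨ p.2 = z.2
  · exact le_card_missing_of_shared hn hxz.symm hyz.symm hxy hz hx hy
      (fun σ => by rw [h𝓣]; tauto) hpz
  push Not at hpx hpy hpz
  have hrow : ∀ {a b : Fin n × Fin n}, a ≠ b → τ a.1 = a.2 → τ b.1 = b.2 → a.1 ≠ b.1 :=
    fun hab ha hb h => hab (Prod.ext h (by rw [← ha, ← hb, h]))
  have h1 := card_le_two_mul_card_missing (hrow hxy hx hy) (hrow hxz hx hz) hpx.1 hpy.1 hpz.1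
    hpx.2
  have h2 := card_le_two_mul_card_missing (hrow hxy.symm hy hx) (hrow hyz hy hz) hpy.1 hpx.1
    hpz.1 hpy.2
  rw [card_through_pair_missing hn hxy hxz hyz hx hy hz] at h1
  rw [card_through_pair_missing hn hxy.symm hyz hxz hy hx hz] at h2
  set A := missing (missing (through (Finset.univ : Finset (Equiv.Perm (Fin n))) {y, z}) {x}) {p}
    with hA
  set B := missing (missing (through (Finset.univ : Finset (Equiv.Perm (Fin n))) {x, z}) {y}) {p}
    with hB
  have hdisj : Disjoint A B := by
    rw [Finset.disjoint_left]
    intro σ hσA hσB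
    rw [hA, mem_missing_singleton, mem_missing_singleton] at hσA
    rw [hB, mem_missing_singleton, mem_missing_singleton, mem_through_pair] at hσB
    exact hσA.1.2 hσB.1.1.2.1
  have hsub : A ∪ B ⊆ missing 𝓣 {p} := by
    intro σ hσ
    rw [mem_missing_singleton, h𝓣]
    rcases Finset.mem_union.1 hσ with h | h
    · rw [hA, mem_missing_singleton, mem_missing_singleton, mem_through_pair] at h
      exact ⟨Or.inr (Or.inr h.1.1.2), h.2⟩
    · rw [hB, mem_missing_singleton, mem_missing_singleton, mem_through_pair] at h
      exact ⟨Or.inr (Or.inl h.1.1.2), h.2⟩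
  have h3 := Finset.card_le_card hsub
  rw [Finset.card_union_of_disjoint hdisj] at h3
  omega

end TwoOfThree

theorem triangleFamily_spec (hn : 3 ≤ n) :
    IsIntersectingPerms (triangleFamily n) ∧
      permDiversity (triangleFamily n) = (n - 3) * (n - 3)! := by
  obtain ⟨a, ha⟩ : ∃ a : Fin n, a.val = 0 := ⟨⟨0, by omega⟩, rfl⟩
  obtain ⟨b, hb⟩ : ∃ b : Fin n, b.val = 1 := ⟨⟨1, by omega⟩, rfl⟩
  obtain ⟨c, hc⟩ : ∃ c : Fin n, c.val = 2 := ⟨⟨2, by omega⟩, rfl⟩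
  have hab : ((a, a) : Fin n × Fin n) ≠ (b, b) := by
    intro h; have := congrArg (fun q => (Prod.fst q).val) h; simp [ha, hb] at this
  have hac : ((a, a) : Fin n × Fin n) ≠ (c, c) := by
    intro h; have := congrArg (fun q => (Prod.fst q).val) h; simp [ha, hc] at this
  have hbc : ((b, b) : Fin n × Fin n) ≠ (c, c) := by
    intro h; have := congrArg (fun q => (Prod.fst q).val) h; simp [hb, hc] at this
  have htriple : diagonalTriple n = {(a, a), (b, b), (c, c)} := by
    ext ⟨i, j⟩
    simp only [diagonalTriple, Finset.mem_filter, Finset.mem_univ, true_and, Finset.mem_insert,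
      Finset.mem_singleton, Prod.mk.injEq, Fin.ext_iff, ha, hb, hc]
    omega
  have hmem : ∀ σ, σ ∈ triangleFamily n ↔
      (σ a = a ∧ σ b = b) ∨ (σ a = a ∧ σ c = c) ∨ (σ b = b ∧ σ c = c) := by
    intro σ
    rw [triangleFamily, Finset.mem_filter, htriple, Finset.inter_comm, ← Finset.filter_mem_eq_inter,
      two_le_card_filter_triple hab hac hbc]
    simp [mem_permEdge]
  constructor
  · intro σ hσ π hπ
    rw [hmem] at hσ hπ
    by_contra! h
    have h1 := h a
    have h2 := h b
    have h3 := h c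
    rcases hσ with ⟨p, q⟩ | ⟨p, q⟩ | ⟨p, q⟩ <;> rcases hπ with ⟨r, s⟩ | ⟨r, s⟩ | ⟨r, s⟩ <;>
      simp_all
  · rw [permDiversity_eq]
    have : Nonempty (Fin n × Fin n) := ⟨(a, a)⟩
    refine le_antisymm ?_ (le_ciInf fun p => ?_)
    · refine (ciInf_le (OrderBot.bddBelow _) (a, a)).trans ?_
      rw [← card_through_pair_missing (τ := 1) hn hab hac hbc rfl rfl rfl]
      refine Finset.card_le_card fun σ hσ => ?_
      rw [mem_missing_singleton, hmem] at hσ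
      rw [mem_missing_singleton, mem_through_pair]
      have h2 : σ a ≠ a := hσ.2
      exact ⟨⟨Finset.mem_univ _, by tauto⟩, hσ.2⟩
    · exact le_card_missing (τ := 1) hn hab hac hbc rfl rfl rfl hmem p

end Permutations

theorem theorem1p4 :
    (∀ (n : ℕ), 500 ≤ n → ∀ (𝓕 : Finset (Equiv.Perm (Fin n))), IsIntersectingPerms 𝓕 →
      permDiversity 𝓕 ≤ (n - 3) * (n - 3)!) ∧
    (∀ (n : ℕ), 3 ≤ n →
      IsIntersectingPerms (triangleFamily n) ∧
      permDiversity (triangleFamily n) = (n - 3) * (n - 3)!) := by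
  refine ⟨fun n hn 𝓕 h𝓕 => ?_, fun n hn => triangleFamily_spec hn⟩
  obtain ⟨x, hx⟩ := exists_card_missing_le hn h𝓕
  rw [permDiversity_eq]
  exact (ciInf_le (OrderBot.bddBelow _) x).trans hx
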